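/- Let $\Gamma\subset\mathbb R^2$ be a finite curve of length $L>0$, the range of a $C^2$ arc length parameterization $\gamma:[0,L]\to\mathbb R^2$ without self-intersections ($\gamma$ injective on $[0,L]$; or $\Gamma$ is closed, i.e. $\gamma$ is injective on $[0,L)$, $\gamma(0)=\gamma(L)$, and the first two derivatives of $\gamma$ agree at $0$ and $L$). Let $\sigma_\Gamma$ be its arc length measure, $K=\max|\gamma''|$, and $R$ the radius of the smallest disc containing the convex hull of $\{x:\operatorname{dist}(x,\Gamma)\le 1\}$. For a map $\beta$ on $[0,L]$ let $M_\beta(m)$ be the largest $c$ with $c|s-s'|\le|\beta(s)-\beta(s')|$ for all $s,s'\in[0,L]$, $|s-s'|\le m$. Put $M=\min\{M_\gamma(L/2),M_{\tilde\gamma}(L/2)\}$ if $\Gamma$ is closed, where $\tilde\gamma$ is $\gamma$ with its starting point moved to $\gamma(L/2)$, and $M=M_\gamma(L)$ if $\Gamma$ is not closed. For $\alpha>0$ let $H_{\alpha\sigma_\Gamma}$ be the selfadjoint operator in $L^2(\mathbb R^2)$ associated with the form $$\mathcal E(\psi,\phi)=\int_{\mathbb R^2}\nabla\psi\cdot\nabla\overline\phi\,dx-\alpha\int_{\Gamma}\psi\,\overline\phi\,d\sigma_\Gamma,\qquad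 \psi,\phi\in W^{1,2}(\mathbb R^2),$$ where $\psi,\phi$ stand for their traces in the integral over $\Gamma$. There are an absolute constant $\eta_0>0$ and functions $c_3=c_3(M,K)$ and $c_4=c_4(M)>0$ such that the following hold for every such $\Gamma$. (a) Let $y\in\mathbb R^2\setminus\Gamma$ and let $e$ be a unit vector such that the ray $\{y-te:t\ge0\}$ meets $\Gamma$, for the first time at $\gamma(s_y)=y-de$. Put $\cos\theta=\langle e,\gamma'(s_y)\rangle$, $\delta_0=\min\{\frac L2,\frac{M_\gamma(L/2)}{2K}\,\frac{1-|\cos\theta|}2\}$ (with $\delta_0=\frac L2$ if $K=0$) and $b_1=M\delta_0/2$. If $|\cos\theta|\le\sqrt3/2$ and $d\le\min\{1,b_1\}$, then $$\frac1{2\pi}\int_\Gamma\frac{d\sigma_\Gamma(x)}{|y-x|}\le c_3+c_4\,(\log L+|\log d|).$$ (b) With $c_5=\max\{2c_4,\ c_3+c_4\log(\max\{1,L\})\}$, for all $\alpha>0$, $\kappa>0$ and every eigenfunction $\psi$ of $H_{\alpha\sigma_\Gamma}$ with eigenvalue $-\kappa^2$, $\psi$ is bounded and $$\|\psi\|_2\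 \ge\ \frac{\kappa R}{(c_5\alpha+1)^2(\kappa^2+1)}\,e^{-\eta_0\kappa R}\,\|\psi\|_\infty .$$ -/

import Mathlib

open scoped ContDiff

noncomputable section

namespace LeakyCurve

/-- The Euclidean plane. -/
abbrev Plane : Type := EuclideanSpace ℝ (Fin 2)

/-! ### The Sobolev space of the plane -/

/-- The `i`-th classical partial derivative of a function on the plane. -/
def partialDeriv (i : Fin 2) (f : Plane → ℂ) (x : Plane) : ℂ :=
  fderiv ℝ f x (EuclideanSpace.single i (1 : ℝ))

/-- Test functions: smooth with compact support. -/
def IsTestFunction (φ : Plane → ℂ) : Prop :=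
  ContDiff ℝ ∞ φ ∧ HasCompactSupport φ

/-- `u` belongs to `W^{1,2}` of the plane, and `g` is its weak gradient. -/
structure HasSobolevGradient (u : Plane → ℂ) (g : Fin 2 → Plane → ℂ) : Prop where
  memLp : MeasureTheory.MemLp u 2
  memLp_grad : ∀ i, MeasureTheory.MemLp (g i) 2
  weak : ∀ i, ∀ φ : Plane → ℂ, IsTestFunction φ →
    ∫ x, u x * partialDeriv i φ x = - ∫ x, g i x * φ x

/-- `tr` is the trace in `L²(σ)` of the function `u` of `W^{1,2}` with weak gradient `g`: the
trace map is the continuous extension to `W^{1,2}` of the restriction of test functions, so `tr` is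
the `L²(σ)`-limit of the restrictions of test functions which converge to `u` in `W^{1,2}`. -/
structure IsTrace (σ : MeasureTheory.Measure Plane) (u : Plane → ℂ) (g : Fin 2 → Plane → ℂ)
    (tr : Plane → ℂ) : Prop where
  memLp : MeasureTheory.MemLp tr 2 σ
  approx : ∃ φ : ℕ → Plane → ℂ, (∀ n, IsTestFunction (φ n)) ∧
    Filter.Tendsto (fun n => MeasureTheory.eLpNorm (fun x => φ n x - u x) 2 MeasureTheory.volume)
      Filter.atTop (nhds 0) ∧
    (∀ i, Filter.Tendsto
      (fun n => MeasureTheory.eLpNorm (fun x => partialDeriv i (φ n) x - g i x) 2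
        MeasureTheory.volume) Filter.atTop (nhds 0)) ∧
    Filter.Tendsto (fun n => MeasureTheory.eLpNorm (fun x => φ n x - tr x) 2 σ)
      Filter.atTop (nhds 0)

/-! ### Finite curves -/

/-- A finite `C²` curve in the plane without self-intersections, parameterized by arc length on
`[0, length]`. It may be closed; then the first two derivatives of the parameterization agree
at the two ends of the interval. Values of `param` outside the interval are irrelevant. -/
structure FiniteCurve where
  length : ℝ
  length_pos : 0 < length
  param : ℝ → Plane
  contDiffOn : ContDiffOn ℝ 2 param (Set.Icc 0 length)
  unit_speed : ∀ s ∈ Set.Icc 0 length, ‖derivWithin param (Set.Icc 0 length) s‖ = 1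
  simple : Set.InjOn param (Set.Icc 0 length) ∨
    (Set.InjOn param (Set.Ico 0 length) ∧ param 0 = param length ∧
      derivWithin param (Set.Icc 0 length) 0 = derivWithin param (Set.Icc 0 length) length ∧
      iteratedDerivWithin 2 param (Set.Icc 0 length) 0 =
        iteratedDerivWithin 2 param (Set.Icc 0 length) length)

namespace FiniteCurve

variable (Γ : FiniteCurve)

/-- The curve as a set of points. -/
def carrier : Set Plane := Γ.param '' Set.Icc 0 Γ.length

/-- The curve is closed. -/
def IsLoop : Prop := Γ.param 0 = Γ.param Γ.length

/-- The unit tangent vector at the parameter `s`. -/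
def tangent (s : ℝ) : Plane := derivWithin Γ.param (Set.Icc 0 Γ.length) s

/-- The arc length measure of the curve, as a measure on the plane. -/
def arcMeasure : MeasureTheory.Measure Plane :=
  (MeasureTheory.volume.restrict (Set.Icc 0 Γ.length)).map Γ.param

/-- The maximal curvature `K`. -/
def maxCurvature : ℝ :=
  sSup ((fun s => ‖iteratedDerivWithin 2 Γ.param (Set.Icc 0 Γ.length) s‖) '' Set.Icc 0 Γ.length)

/-- The radius `R` of the smallest disc which contains the convex hull of the closed
`1`-neighbourhood of the curve. -/
def radius : ℝ :=
  sInf {r : ℝ | 0 < r ∧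
    ∃ x : Plane, convexHull ℝ (Metric.cthickening 1 Γ.carrier) ⊆ Metric.closedBall x r}

/-- For a map `γ` on `[0, L]`, the largest `c` with `c * |s - s'| ≤ |γ(s) - γ(s')|` for all
`s, s'` in `[0, L]` such that `|s - s'| ≤ m`. -/
def chordArc (γ : ℝ → Plane) (L m : ℝ) : ℝ :=
  sSup {c : ℝ | ∀ s ∈ Set.Icc 0 L, ∀ s' ∈ Set.Icc 0 L, |s - s'| ≤ m →
    c * |s - s'| ≤ ‖γ s - γ s'‖}

/-- The parameterization of a closed curve which starts at the point of parameter `L / 2`. -/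
def shiftedParam (s : ℝ) : Plane :=
  if s < Γ.length / 2 then Γ.param (s + Γ.length / 2) else Γ.param (s - Γ.length / 2)

open Classical in
/-- The injectivity constant `M` of the curve: for a closed curve, the best chord-arc constant for
arcs of length at most `L / 2`; for a curve with two ends, the best chord-arc constant. -/
def injConst : ℝ :=
  if Γ.IsLoop then
    min (chordArc Γ.param Γ.length (Γ.length / 2))
      (chordArc Γ.shiftedParam Γ.length (Γ.length / 2))
  else chordArc Γ.param Γ.length Γ.length

open Classical in
/-- The length `δ₀` as a function of the cosine of the angle of intersection (for a straight
segment, whose curvature vanishes, the second term of the minimum is infinite). -/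
def delta₀ (cosθ : ℝ) : ℝ :=
  if Γ.maxCurvature = 0 then Γ.length / 2
  else min (Γ.length / 2)
    (chordArc Γ.param Γ.length (Γ.length / 2) / (2 * Γ.maxCurvature) * ((1 - |cosθ|) / 2))

/-- The threshold `b₁ = M δ₀ / 2`. -/
def b₁ (cosθ : ℝ) : ℝ := Γ.injConst * Γ.delta₀ cosθ / 2

/-- The constants `a₃, a₄` bound the potential of the kernel `1 / (2π|x|)` of the curve in terms
of the distance to the curve along a line. Here `e` is the unit vector of the line,
`d` is the distance from `y` to the first point `γ(s)` of the curve that is met from `y` in the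
direction `-e`, and the line and the curve intersect there at an angle whose cosine is at most
`√3 / 2` in absolute value. -/
def LogDistanceBound (a₃ a₄ : ℝ) : Prop :=
  ∀ (y e : Plane) (d s : ℝ), y ∉ Γ.carrier → ‖e‖ = 1 → s ∈ Set.Icc 0 Γ.length →
    0 ≤ d → Γ.param s = y - d • e →
    (∀ t : ℝ, 0 ≤ t → t < d → y - t • e ∉ Γ.carrier) →
    |inner ℝ e (Γ.tangent s)| ≤ √3 / 2 →
    d ≤ min 1 (Γ.b₁ (inner ℝ e (Γ.tangent s))) →
    1 / (2 * Real.pi) * ∫ x, 1 / ‖y - x‖ ∂Γ.arcMeasure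
      ≤ a₃ + a₄ * (Real.log Γ.length + |Real.log d|)

end FiniteCurve

/-- The constant `c₅`, computed from `c₃`, `c₄` and the length `L`. -/
def c₅ (a₃ a₄ L : ℝ) : ℝ := max (2 * a₄) (a₃ + a₄ * Real.log (max 1 L))

/-! ### The Hamiltonian -/

/-- The form `∫ ∇ψ · conj ∇φ - α ∫ ψ conj φ dσ`, in terms of the weak gradients `gψ`, `gφ` and of
the traces `tψ`, `tφ` of the two functions. -/
def form (σ : MeasureTheory.Measure Plane) (α : ℝ) (gψ : Fin 2 → Plane → ℂ) (tψ : Plane → ℂ)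
    (gφ : Fin 2 → Plane → ℂ) (tφ : Plane → ℂ) : ℂ :=
  (∫ x, ∑ i, gψ i x * (starRingEnd ℂ) (gφ i x)) - α * ∫ x, tψ x * (starRingEnd ℂ) (tφ x) ∂σ

/-- `ψ` is in the domain of the selfadjoint operator `H` associated with the form, and `H ψ = f`:
`ψ ∈ W^{1,2}`, `f ∈ L²` and the form of `(ψ, φ)` is the scalar product `(f, φ)` for all
`φ ∈ W^{1,2}`. -/
def HamiltonianMaps (Γ : FiniteCurve) (α : ℝ) (ψ f : Plane → ℂ) : Prop :=
  MeasureTheory.MemLp f 2 ∧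
  ∃ (gψ : Fin 2 → Plane → ℂ) (tψ : Plane → ℂ),
    HasSobolevGradient ψ gψ ∧ IsTrace Γ.arcMeasure ψ gψ tψ ∧
    ∀ (φ : Plane → ℂ) (gφ : Fin 2 → Plane → ℂ) (tφ : Plane → ℂ),
      HasSobolevGradient φ gφ → IsTrace Γ.arcMeasure φ gφ tφ →
      form Γ.arcMeasure α gψ tψ gφ tφ = ∫ x, f x * (starRingEnd ℂ) (φ x)

/-- `ψ` is an eigenfunction of the Hamiltonian with eigenvalue `E`. -/
def IsEigenfunction (Γ : FiniteCurve) (α E : ℝ) (ψ : Plane → ℂ) : Prop :=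
  HamiltonianMaps Γ α ψ (fun x => (E : ℂ) * ψ x) ∧
    ¬ (ψ =ᵐ[MeasureTheory.volume] fun _ => 0)

end LeakyCurve

end

noncomputable section

namespace LeakyCurve

/-! Both parts rest on the positivity of the injectivity constant `M` (tangent approximation at
short range, compactness elsewhere). Since `M` controls the shorter arc between any two points of
the curve, it carries all the geometry.

(a) Let `h` be the signed arc length from the first hit point to `γ(s)`. Then `|y - γ(s)| ≥ (M/20)
max(d, |h|)`. For `|h| ≤ δ₀` the curve stays near its tangent, which makes a definite angle with the
ray. For `|h| > δ₀` the chord is at least `M|h| > Mδ₀ ≥ 2d`. Integrating `1/(d + |h|)` gives the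
logarithm (`exists_isArc_max_le_norm_sub`, `logDistanceBound`).

(b) The claim follows from a local bound `‖ψ‖_∞ ≤ C (40Dα + 1)(κ² + 1) ‖ψ‖₂` with `C` absolute and
`D = 4/M`. With `η₀ = C`, the inequality `κR exp(-CκR) ≤ 1/C` removes `κR` and `C` together,
whatever the value of `R`. Since `c₅ ≥ 2c₄ = 40D`, the rest is at most 1.

For the local bound (`eLpNorm_top_le`), a disc of radius `ρ` has arc length measure at most `Dρ`,
which yields a trace inequality. With the energy identity it bounds the trace of `ψ` in `L²(σ)` by
`‖ψ‖₂`. The form is then tested with a smooth truncated logarithmic kernel at scales `ε < r`, whose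
Laplacian is the difference of two mollifiers. This writes the `ε`-average of `ψ` as its `r`-average
plus pairings of the kernel with the trace and with `ψ`, all bounded uniformly in `ε` by
Cauchy-Schwarz. Lebesgue differentiation as `ε → 0` concludes. -/

namespace FiniteCurve

/-! ### Tangent approximation and arcs of the curve -/

open Set

variable (Γ : FiniteCurve)

theorem uniqueDiffOn_Icc_length : UniqueDiffOn ℝ (Icc 0 Γ.length) :=
  uniqueDiffOn_Icc Γ.length_pos

theorem hasDerivWithinAt_param {s : ℝ} (hs : s ∈ Icc 0 Γ.length) :
    HasDerivWithinAt Γ.param (Γ.tangent s) (Icc 0 Γ.length) s :=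
  ((Γ.contDiffOn.differentiableOn (by norm_num)) s hs).hasDerivWithinAt

theorem continuousOn_param : ContinuousOn Γ.param (Icc 0 Γ.length) :=
  Γ.contDiffOn.continuousOn

theorem hasDerivWithinAt_tangent {s : ℝ} (hs : s ∈ Icc 0 Γ.length) :
    HasDerivWithinAt Γ.tangent (iteratedDerivWithin 2 Γ.param (Icc 0 Γ.length) s)
      (Icc 0 Γ.length) s := by
  have h : DifferentiableOn ℝ (iteratedDerivWithin 1 Γ.param (Icc 0 Γ.length)) (Icc 0 Γ.length) :=
    Γ.contDiffOn.differentiableOn_iteratedDerivWithin (by norm_num) Γ.uniqueDiffOn_Icc_length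
  have h1 := (h s hs).hasDerivWithinAt
  have h2 : iteratedDerivWithin 1 Γ.param (Icc 0 Γ.length) = Γ.tangent := by
    ext1 x
    rw [iteratedDerivWithin_one]
    rfl
  rw [← iteratedDerivWithin_succ, h2] at h1
  exact h1

theorem norm_iteratedDerivWithin_le {s : ℝ} (hs : s ∈ Icc 0 Γ.length) :
    ‖iteratedDerivWithin 2 Γ.param (Icc 0 Γ.length) s‖ ≤ Γ.maxCurvature := by
  have hc : ContinuousOn (fun s => ‖iteratedDerivWithin 2 Γ.param (Icc 0 Γ.length) s‖)
      (Icc 0 Γ.length) :=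
    (Γ.contDiffOn.continuousOn_iteratedDerivWithin le_rfl Γ.uniqueDiffOn_Icc_length).norm
  exact le_csSup (isCompact_Icc.bddAbove_image hc) (mem_image_of_mem _ hs)

theorem maxCurvature_nonneg : 0 ≤ Γ.maxCurvature :=
  (norm_nonneg _).trans (Γ.norm_iteratedDerivWithin_le ⟨le_rfl, Γ.length_pos.le⟩)

theorem norm_tangent {s : ℝ} (hs : s ∈ Icc 0 Γ.length) : ‖Γ.tangent s‖ = 1 :=
  Γ.unit_speed s hs

theorem norm_tangent_sub_le {s s' : ℝ} (hs : s ∈ Icc 0 Γ.length) (hs' : s' ∈ Icc 0 Γ.length) :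
    ‖Γ.tangent s' - Γ.tangent s‖ ≤ Γ.maxCurvature * |s' - s| :=
  (convex_Icc 0 Γ.length).norm_image_sub_le_of_norm_hasDerivWithin_le
    (fun _ hx => Γ.hasDerivWithinAt_tangent hx) (fun _ hx => Γ.norm_iteratedDerivWithin_le hx) hs hs'

theorem norm_param_sub_le {s s' : ℝ} (hs : s ∈ Icc 0 Γ.length) (hs' : s' ∈ Icc 0 Γ.length) :
    ‖Γ.param s' - Γ.param s‖ ≤ |s' - s| := by
  simpa using (convex_Icc 0 Γ.length).norm_image_sub_le_of_norm_hasDerivWithin_le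
    (fun _ hx => Γ.hasDerivWithinAt_param hx) (fun _ hx => (Γ.norm_tangent hx).le) hs hs'

/-- Mean value inequality for `γ(x) - xγ'(s)`, whose derivative is at most `K|s' - s|` between `s`
and `s'`. The sharp factor `1/2` is not needed. -/
theorem norm_param_sub_sub_le {s s' : ℝ} (hs : s ∈ Icc 0 Γ.length) (hs' : s' ∈ Icc 0 Γ.length) :
    ‖Γ.param s' - Γ.param s - (s' - s) • Γ.tangent s‖ ≤ Γ.maxCurvature * (s' - s) ^ 2 := by
  have hsub : uIcc s s' ⊆ Icc 0 Γ.length := ordConnected_Icc.uIcc_subset hs hs'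
  have hd : ∀ x ∈ uIcc s s', HasDerivWithinAt (fun x => Γ.param x - x • Γ.tangent s)
      (Γ.tangent x - (1 : ℝ) • Γ.tangent s) (uIcc s s') x := fun x hx =>
    ((Γ.hasDerivWithinAt_param (hsub hx)).mono hsub).sub
      ((hasDerivWithinAt_id x _).smul_const _)
  have hb : ∀ x ∈ uIcc s s', ‖Γ.tangent x - (1 : ℝ) • Γ.tangent s‖ ≤
      Γ.maxCurvature * |s' - s| := by
    intro x hx
    rw [one_smul]
    refine (Γ.norm_tangent_sub_le hs (hsub hx)).trans ?_
    exact mul_le_mul_of_nonneg_left (abs_sub_left_of_mem_uIcc hx) Γ.maxCurvature_nonneg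
  have := (convex_uIcc s s').norm_image_sub_le_of_norm_hasDerivWithin_le hd hb
    left_mem_uIcc right_mem_uIcc
  rw [Real.norm_eq_abs, mul_assoc, abs_mul_abs_self, ← sq] at this
  have e : Γ.param s' - Γ.param s - (s' - s) • Γ.tangent s =
      Γ.param s' - s' • Γ.tangent s - (Γ.param s - s • Γ.tangent s) := by module
  rw [e]
  exact this

theorem tangent_zero_eq (h : Γ.IsLoop) : Γ.tangent 0 = Γ.tangent Γ.length := by
  rcases Γ.simple with h1 | h1
  · exact absurd (h1 ⟨le_rfl, Γ.length_pos.le⟩ ⟨Γ.length_pos.le, le_rfl⟩ h) Γ.length_pos.ne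
  · exact h1.2.2.1

/-- `h` is a signed arc length along which the curve runs from parameter `s` to parameter `s'`. -/
def IsArc (s s' h : ℝ) : Prop :=
  h = s' - s ∨ Γ.IsLoop ∧ (h = s' - s + Γ.length ∨ h = s' - s - Γ.length)

variable {Γ}

/-- An arc through the junction of a loop is cut there into pieces of lengths `p` and `q`. The
tangents at `0` and at the full length agree, so the errors are `Kp²`, `Kq²` and `Kpq` (from turning
the tangent), with sum at most `K(p + q)²`. -/
theorem IsArc.norm_sub_sub_le {s s' h : ℝ} (H : Γ.IsArc s s' h) (hs : s ∈ Icc 0 Γ.length)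
    (hs' : s' ∈ Icc 0 Γ.length) :
    ‖Γ.param s' - Γ.param s - h • Γ.tangent s‖ ≤ Γ.maxCurvature * h ^ 2 := by
  have h0 : (0 : ℝ) ∈ Icc 0 Γ.length := ⟨le_rfl, Γ.length_pos.le⟩
  have hL : Γ.length ∈ Icc 0 Γ.length := ⟨Γ.length_pos.le, le_rfl⟩
  have hK := Γ.maxCurvature_nonneg
  rcases H with rfl | ⟨hl, rfl | rfl⟩
  · exact Γ.norm_param_sub_sub_le hs hs'
  · have e1 := Γ.norm_param_sub_sub_le h0 hs'
    have e2 := Γ.norm_param_sub_sub_le hs hL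
    have e3 := Γ.norm_tangent_sub_le hs hL
    have ht := Γ.tangent_zero_eq hl
    have hl' : Γ.param 0 = Γ.param Γ.length := hl
    rw [ht, hl', sub_zero] at e1
    rw [abs_of_nonneg (sub_nonneg.2 hs.2)] at e3
    have : Γ.param s' - Γ.param s - (s' - s + Γ.length) • Γ.tangent s =
      (Γ.param s' - Γ.param Γ.length - s' • Γ.tangent Γ.length) +
      (Γ.param Γ.length - Γ.param s - (Γ.length - s) • Γ.tangent s) +
      s' • (Γ.tangent Γ.length - Γ.tangent s) := by module
    rw [this]
    refine (norm_add₃_le).trans ?_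
    rw [norm_smul, Real.norm_eq_abs, abs_of_nonneg hs'.1]
    have h4 := mul_le_mul_of_nonneg_left e3 hs'.1
    have h5 := mul_nonneg hK (mul_nonneg hs'.1 (sub_nonneg.2 hs.2))
    nlinarith
  · have e1 := Γ.norm_param_sub_sub_le hL hs'
    have e2 := Γ.norm_param_sub_sub_le hs h0
    have e3 := Γ.norm_tangent_sub_le hs h0
    have ht := Γ.tangent_zero_eq hl
    have hl' : Γ.param 0 = Γ.param Γ.length := hl
    rw [ht, zero_sub, abs_neg, abs_of_nonneg hs.1] at e3
    rw [hl', zero_sub] at e2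
    have : Γ.param s' - Γ.param s - (s' - s - Γ.length) • Γ.tangent s =
      (Γ.param s' - Γ.param Γ.length - (s' - Γ.length) • Γ.tangent Γ.length) +
      (Γ.param Γ.length - Γ.param s - (-s) • Γ.tangent s) +
      (s' - Γ.length) • (Γ.tangent Γ.length - Γ.tangent s) := by module
    rw [this]
    refine (norm_add₃_le).trans ?_
    rw [norm_smul, Real.norm_eq_abs, abs_of_nonpos (sub_nonpos.2 hs'.2), neg_sub]
    have h4 := mul_le_mul_of_nonneg_left e3 (sub_nonneg.2 hs'.2)
    have h5 := mul_nonneg hK (mul_nonneg hs.1 (sub_nonneg.2 hs'.2))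
    nlinarith

theorem IsArc.le_norm_sub {s s' h : ℝ} (H : Γ.IsArc s s' h) (hs : s ∈ Icc 0 Γ.length)
    (hs' : s' ∈ Icc 0 Γ.length) (hh : Γ.maxCurvature * |h| ≤ 1 / 2) :
    1 / 2 * |h| ≤ ‖Γ.param s - Γ.param s'‖ := by
  have h1 := H.norm_sub_sub_le hs hs'
  have h2 : ‖h • Γ.tangent s‖ = |h| := by
    rw [norm_smul, Γ.norm_tangent hs, mul_one, Real.norm_eq_abs]
  have h3 := norm_sub_norm_le (h • Γ.tangent s) (Γ.param s' - Γ.param s)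
  rw [norm_sub_rev _ (Γ.param s' - Γ.param s), h2, norm_sub_rev (Γ.param s')] at h3
  rw [← sq_abs] at h1
  nlinarith [abs_nonneg h]

variable (Γ)

theorem param_ne_of_lt {δ s s' : ℝ} (hδ : 0 < δ) (hs : s ∈ Icc 0 Γ.length)
    (hs' : s' ∈ Icc 0 Γ.length) (hlt : s < s') (hloop : Γ.IsLoop → |s - s'| ≤ Γ.length - δ) :
    Γ.param s ≠ Γ.param s' := by
  intro he
  rcases Γ.simple with h1 | h1
  · exact hlt.ne (h1 hs hs' he)
  · have hloop := hloop h1.2.1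
    rw [abs_of_neg (by linarith)] at hloop
    have hs1 : s ∈ Ico 0 Γ.length := ⟨hs.1, by linarith [hs'.2]⟩
    rcases hs'.2.lt_or_eq with h2 | h2
    · exact hlt.ne (h1.1 hs1 ⟨hs'.1, h2⟩ he)
    · rw [h2, ← h1.2.1] at he
      have := h1.1 hs1 ⟨le_rfl, Γ.length_pos⟩ he
      subst this
      linarith

/-- For arcs shorter than `δ` the tangent approximation gives the constant `1/2`. The remaining
pairs of parameters form a compact set on which the chord does not vanish. This is what makes `M`
positive. -/
theorem exists_pos_forall_le_norm_sub : ∃ c : ℝ, 0 < c ∧ ∀ s ∈ Icc 0 Γ.length,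
    ∀ s' ∈ Icc 0 Γ.length, ∀ h, Γ.IsArc s s' h → (Γ.IsLoop → |h| ≤ Γ.length / 2) →
      c * |h| ≤ ‖Γ.param s - Γ.param s'‖ := by
  have hK := Γ.maxCurvature_nonneg
  have hL := Γ.length_pos
  obtain ⟨δ, hδ, hδL, hδK⟩ : ∃ δ : ℝ, 0 < δ ∧ δ ≤ Γ.length / 2 ∧ Γ.maxCurvature * δ ≤ 1 / 2 := by
    refine ⟨min (Γ.length / 2) (1 / (2 * (Γ.maxCurvature + 1))), by positivity, min_le_left _ _, ?_⟩
    refine (mul_le_mul_of_nonneg_left (min_le_right _ _) hK).trans ?_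
    rw [mul_one_div, div_le_div_iff₀ (by positivity) (by norm_num)]
    linarith
  -- For a loop, pairs close to opposite ends of the interval are also near each other on the curve,
  -- so they are excluded too.
  let P : Set (ℝ × ℝ) := (Icc 0 Γ.length ×ˢ Icc 0 Γ.length) ∩
    {p | δ ≤ |p.1 - p.2| ∧ (Γ.IsLoop → |p.1 - p.2| ≤ Γ.length - δ)}
  have hP : IsCompact P := by
    refine (isCompact_Icc.prod isCompact_Icc).inter_right ?_
    refine IsClosed.and (isClosed_le (by fun_prop) (by fun_prop)) ?_
    by_cases hl : Γ.IsLoop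
    · simpa [hl] using isClosed_le (f := fun p : ℝ × ℝ => |p.1 - p.2|) (by fun_prop) (by fun_prop)
    · simp [hl]
  have hf : ContinuousOn (fun p : ℝ × ℝ => ‖Γ.param p.1 - Γ.param p.2‖) P := by
    refine ((Γ.continuousOn_param.comp continuousOn_fst ?_).sub
      (Γ.continuousOn_param.comp continuousOn_snd ?_)).norm
    · exact fun p hp => hp.1.1
    · exact fun p hp => hp.1.2
  have hpos : ∀ p ∈ P, 0 < ‖Γ.param p.1 - Γ.param p.2‖ := by
    rintro ⟨s, s'⟩ ⟨⟨hs, hs'⟩, hd, hloop⟩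
    simp only at hs hs' hd hloop ⊢
    rw [norm_pos_iff, sub_ne_zero]
    rcases lt_trichotomy s s' with h | h | h
    · exact Γ.param_ne_of_lt hδ hs hs' h hloop
    · rw [h, sub_self, abs_zero] at hd
      linarith
    · rw [abs_sub_comm] at hloop
      exact (Γ.param_ne_of_lt hδ hs' hs h hloop).symm
  obtain ⟨c, hc, hcP⟩ := hP.exists_forall_le' hf hpos
  refine ⟨min (1 / 2) (c / Γ.length), by positivity, fun s hs s' hs' h H hh => ?_⟩
  have hLle : |h| ≤ Γ.length := by
    by_cases hl : Γ.IsLoop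
    · linarith [hh hl]
    · rcases H with rfl | H
      · rw [abs_le]
        constructor <;> linarith [hs.1, hs.2, hs'.1, hs'.2]
      · exact absurd H.1 hl
  rcases le_or_gt (|h|) δ with h1 | h1
  · refine le_trans ?_ (H.le_norm_sub hs hs'
      ((mul_le_mul_of_nonneg_left h1 hK).trans hδK))
    exact mul_le_mul_of_nonneg_right (min_le_left _ _) (abs_nonneg _)
  · have hmem : (s, s') ∈ P := by
      refine ⟨⟨hs, hs'⟩, ?_⟩
      simp only [mem_ofPred_eq]
      rw [abs_sub_comm]
      rcases H with rfl | ⟨hl, H⟩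
      · exact ⟨h1.le, fun hl => by linarith [hh hl]⟩
      · have h2 := hh hl
        rcases H with rfl | rfl
        · rw [abs_of_nonneg (by linarith [hs.2, hs'.1])] at h1 h2
          rw [abs_of_nonpos (by linarith)]
          exact ⟨by linarith, fun _ => by linarith⟩
        · rw [abs_of_nonpos (by linarith [hs.1, hs'.2])] at h1 h2
          rw [abs_of_nonneg (by linarith)]
          exact ⟨by linarith, fun _ => by linarith⟩
    refine le_trans ?_ (hcP (s, s') hmem)
    refine le_of_le_of_eq ?_ (div_mul_cancel₀ c hL.ne')
    exact mul_le_mul (min_le_right _ _) hLle (abs_nonneg _) (by positivity)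

/-! ### Chord-arc constants and the injectivity constant -/

section ChordArc

variable {β : ℝ → Plane} {L m : ℝ}

theorem bddAbove_chordArc (hL : 0 < L) (hm : 0 < m) :
    BddAbove {c : ℝ | ∀ s ∈ Icc 0 L, ∀ s' ∈ Icc 0 L, |s - s'| ≤ m →
      c * |s - s'| ≤ ‖β s - β s'‖} := by
  refine ⟨‖β 0 - β (min L m)‖ / (min L m), fun c hc => ?_⟩
  have hp : 0 < min L m := lt_min hL hm
  have := hc 0 ⟨le_rfl, hL.le⟩ (min L m) ⟨hp.le, min_le_left _ _⟩
    (by rw [zero_sub, abs_neg, abs_of_pos hp]; exact min_le_right _ _)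
  rw [zero_sub, abs_neg, abs_of_pos hp] at this
  rwa [le_div_iff₀ hp]

/-- The supremum is itself admissible: every admissible `c` is at most the ratio of chord to
parameter distance, and `0` is admissible. -/
theorem chordArc_mul_le {s s' : ℝ} (hs : s ∈ Icc 0 L) (hs' : s' ∈ Icc 0 L) (h : |s - s'| ≤ m) :
    chordArc β L m * |s - s'| ≤ ‖β s - β s'‖ := by
  rcases eq_or_ne s s' with rfl | hne
  · simp
  · have hp : 0 < |s - s'| := abs_pos.2 (sub_ne_zero.2 hne)
    rw [← le_div_iff₀ hp]
    refine csSup_le ⟨0, fun _ _ _ _ _ => by simp⟩ fun c hc => ?_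
    rw [le_div_iff₀ hp]
    exact hc s hs s' hs' h

theorem le_chordArc (hL : 0 < L) (hm : 0 < m) {c : ℝ}
    (h : ∀ s ∈ Icc 0 L, ∀ s' ∈ Icc 0 L, |s - s'| ≤ m → c * |s - s'| ≤ ‖β s - β s'‖) :
    c ≤ chordArc β L m :=
  le_csSup (bddAbove_chordArc hL hm) h

end ChordArc

theorem exists_shiftedParam_eq {s : ℝ} (hs : s ∈ Icc 0 Γ.length) :
    ∃ u ∈ Icc 0 Γ.length, Γ.shiftedParam s = Γ.param u ∧
      (u = s + Γ.length / 2 ∨ u = s - Γ.length / 2) := by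
  unfold shiftedParam
  have hL := Γ.length_pos
  split_ifs with h
  · exact ⟨s + Γ.length / 2, ⟨by linarith [hs.1], by linarith⟩, rfl, Or.inl rfl⟩
  · exact ⟨s - Γ.length / 2, ⟨by linarith, by linarith [hs.2]⟩, rfl, Or.inr rfl⟩

theorem chordArc_param_le_one {m : ℝ} (hm : 0 < m) : chordArc Γ.param Γ.length m ≤ 1 := by
  have hL := Γ.length_pos
  have hp : 0 < min Γ.length m := lt_min hL hm
  have h0 : (0 : ℝ) ∈ Icc 0 Γ.length := ⟨le_rfl, hL.le⟩
  have h1 : min Γ.length m ∈ Icc 0 Γ.length := ⟨hp.le, min_le_left _ _⟩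
  have h2 := chordArc_mul_le (β := Γ.param) (m := m) h1 h0
    (by rw [sub_zero, abs_of_pos hp]; exact min_le_right _ _)
  have h3 := h2.trans (Γ.norm_param_sub_le h0 h1)
  rw [sub_zero, abs_of_pos hp] at h3
  nlinarith

theorem injConst_le_chordArc : Γ.injConst ≤ chordArc Γ.param Γ.length (Γ.length / 2) := by
  have hL := Γ.length_pos
  unfold injConst
  split_ifs with h
  · exact min_le_left _ _
  · exact le_chordArc hL (by linarith) fun s hs s' hs' hd =>
      chordArc_mul_le hs hs' (by linarith)

theorem injConst_le_one : Γ.injConst ≤ 1 :=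
  Γ.injConst_le_chordArc.trans (Γ.chordArc_param_le_one (half_pos Γ.length_pos))

theorem injConst_pos : 0 < Γ.injConst := by
  have hL := Γ.length_pos
  obtain ⟨c, hc, h⟩ := Γ.exists_pos_forall_le_norm_sub
  refine hc.trans_le ?_
  unfold injConst
  split_ifs with hl
  · refine le_min (le_chordArc hL (half_pos hL) fun s hs s' hs' hd => ?_)
      (le_chordArc hL (half_pos hL) fun s hs s' hs' hd => ?_)
    · rw [abs_sub_comm] at hd ⊢
      exact h s hs s' hs' _ (Or.inl rfl) fun _ => hd
    · obtain ⟨u, hu, e, hus⟩ := Γ.exists_shiftedParam_eq hs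
      obtain ⟨u', hu', e', hus'⟩ := Γ.exists_shiftedParam_eq hs'
      rw [abs_sub_comm] at hd ⊢
      rw [e, e']
      refine h u hu u' hu' _ ?_ fun _ => hd
      rcases hus with rfl | rfl <;> rcases hus' with rfl | rfl
      · exact Or.inl (by ring)
      · exact Or.inr ⟨hl, Or.inl (by ring)⟩
      · exact Or.inr ⟨hl, Or.inr (by ring)⟩
      · exact Or.inl (by ring)
  · refine le_chordArc hL hL fun s hs s' hs' hd => ?_
    rw [abs_sub_comm]
    exact h s hs s' hs' _ (Or.inl rfl) fun hl' => absurd hl' hl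

/-- When the parameters of two points on a loop differ by more than half the length, the shorter arc
runs through the junction. Moving the starting point to the middle turns it into an ordinary
parameter interval, which is why `M` also involves `shiftedParam`. -/
theorem exists_isArc_injConst_mul_le {s s' : ℝ} (hs : s ∈ Icc 0 Γ.length)
    (hs' : s' ∈ Icc 0 Γ.length) :
    ∃ h, Γ.IsArc s s' h ∧ Γ.injConst * |h| ≤ ‖Γ.param s - Γ.param s'‖ := by
  have hL := Γ.length_pos
  by_cases hl : Γ.IsLoop
  · rcases le_or_gt |s - s'| (Γ.length / 2) with hd | hd
    · refine ⟨s' - s, Or.inl rfl, ?_⟩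
      rw [abs_sub_comm]
      exact le_trans (mul_le_mul_of_nonneg_right Γ.injConst_le_chordArc (abs_nonneg _))
        (chordArc_mul_le hs hs' hd)
    · have hM : Γ.injConst ≤ chordArc Γ.shiftedParam Γ.length (Γ.length / 2) := by
        unfold injConst
        rw [if_pos hl]
        exact min_le_right _ _
      have key : ∀ u ∈ Icc 0 Γ.length, ∀ v ∈ Icc 0 Γ.length, Γ.length / 2 < v - u →
          Γ.injConst * |u - v + Γ.length| ≤ ‖Γ.param u - Γ.param v‖ := by
        intro u hu v hv huv
        have hnot : u + Γ.length / 2 ≤ Γ.length := by linarith [hv.2]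
        have e1 : Γ.shiftedParam (v - Γ.length / 2) = Γ.param v := by
          unfold shiftedParam
          split_ifs with h1
          · congr 1; ring
          -- At the endpoint the shifted curve takes the value `γ(0)`, which is the same point.
          · have : v = Γ.length := by linarith [hv.2]
            rw [this, show Γ.length - Γ.length / 2 - Γ.length / 2 = 0 by ring]
            exact hl
        have e2 : Γ.shiftedParam (u + Γ.length / 2) = Γ.param u := by
          unfold shiftedParam
          rw [if_neg (by linarith [hu.1])]
          congr 1; ring
        have := chordArc_mul_le (β := Γ.shiftedParam) (L := Γ.length) (m := Γ.length / 2)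
          (s := u + Γ.length / 2) (s' := v - Γ.length / 2)
          ⟨by linarith [hu.1], hnot⟩ ⟨by linarith [hu.1], by linarith [hv.2]⟩
          (by rw [abs_le]; constructor <;> linarith [hu.1, hv.2])
        rw [e1, e2, show u + Γ.length / 2 - (v - Γ.length / 2) = u - v + Γ.length by ring] at this
        exact (mul_le_mul_of_nonneg_right hM (abs_nonneg _)).trans this
      rcases le_total s s' with h | h
      · rw [abs_of_nonpos (by linarith)] at hd
        refine ⟨s' - s - Γ.length, Or.inr ⟨hl, Or.inr rfl⟩, ?_⟩
        have := key s hs s' hs' (by linarith)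
        rwa [← abs_neg, show -(s - s' + Γ.length) = s' - s - Γ.length by ring] at this
      · rw [abs_of_nonneg (by linarith)] at hd
        refine ⟨s' - s + Γ.length, Or.inr ⟨hl, Or.inl rfl⟩, ?_⟩
        rw [norm_sub_rev]
        exact key s' hs' s hs hd
  · refine ⟨s' - s, Or.inl rfl, ?_⟩
    rw [abs_sub_comm]
    unfold injConst
    rw [if_neg hl]
    refine chordArc_mul_le hs hs' ?_
    rw [abs_le]
    constructor <;> linarith [hs.1, hs.2, hs'.1, hs'.2]

/-! ### Linear growth of the arc length measure -/

theorem aemeasurable_param :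
    AEMeasurable Γ.param (MeasureTheory.volume.restrict (Icc 0 Γ.length)) :=
  Γ.continuousOn_param.aemeasurable measurableSet_Icc

instance : MeasureTheory.IsFiniteMeasure Γ.arcMeasure := by
  unfold arcMeasure
  infer_instance

/-- The arc length measure of a disc is at most a multiple of its radius. -/
theorem arcMeasure_closedBall_le (x : Plane) {ρ : ℝ} (hρ : 0 ≤ ρ) :
    Γ.arcMeasure (Metric.closedBall x ρ) ≤ ENNReal.ofReal (4 / Γ.injConst * ρ) := by
  have hM := Γ.injConst_pos
  have hL := Γ.length_pos
  unfold arcMeasure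
  rw [MeasureTheory.Measure.map_apply_of_aemeasurable Γ.aemeasurable_param
    Metric.isClosed_closedBall.measurableSet]
  -- Within half of the parameter interval all pairs obey the chord-arc bound, so the preimage of
  -- the disc has diameter at most `2ρ/M`. The two halves together give the factor 4.
  have hhalf : ∀ a b : ℝ, 0 ≤ a → b ≤ Γ.length → b - a ≤ Γ.length / 2 →
      MeasureTheory.volume (Γ.param ⁻¹' Metric.closedBall x ρ ∩ Icc a b) ≤
        ENNReal.ofReal (2 / Γ.injConst * ρ) := by
    intro a b ha hb hab
    refine (Real.volume_le_diam _).trans (Metric.ediam_le fun s hs s' hs' => ?_)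
    rw [edist_dist]
    refine ENNReal.ofReal_le_ofReal ?_
    have h1 : s ∈ Icc 0 Γ.length := ⟨ha.trans hs.2.1, hs.2.2.trans hb⟩
    have h2 : s' ∈ Icc 0 Γ.length := ⟨ha.trans hs'.2.1, hs'.2.2.trans hb⟩
    have h3 : |s - s'| ≤ Γ.length / 2 := by
      rw [abs_le]
      constructor <;> linarith [hs.2.1, hs.2.2, hs'.2.1, hs'.2.2]
    have h4 := chordArc_mul_le (β := Γ.param) h1 h2 h3
    have h5 := mul_le_mul_of_nonneg_right Γ.injConst_le_chordArc (abs_nonneg (s - s'))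
    have h6 := dist_triangle_right (Γ.param s) (Γ.param s') x
    have h7 : dist (Γ.param s) x ≤ ρ := hs.1
    have h8 : dist (Γ.param s') x ≤ ρ := hs'.1
    rw [dist_eq_norm (Γ.param s) (Γ.param s')] at h6
    rw [Real.dist_eq, div_mul_eq_mul_div, le_div_iff₀ hM]
    linarith
  rw [MeasureTheory.Measure.restrict_apply₀' measurableSet_Icc.nullMeasurableSet]
  calc MeasureTheory.volume (Γ.param ⁻¹' Metric.closedBall x ρ ∩ Icc 0 Γ.length)
      ≤ MeasureTheory.volume ((Γ.param ⁻¹' Metric.closedBall x ρ ∩ Icc 0 (Γ.length / 2)) ∪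
          (Γ.param ⁻¹' Metric.closedBall x ρ ∩ Icc (Γ.length / 2) Γ.length)) := by
        refine MeasureTheory.measure_mono ?_
        rw [← inter_union_distrib_left, Icc_union_Icc_eq_Icc (by linarith) (by linarith)]
    _ ≤ ENNReal.ofReal (2 / Γ.injConst * ρ) + ENNReal.ofReal (2 / Γ.injConst * ρ) :=
        (MeasureTheory.measure_union_le _ _).trans (add_le_add
          (hhalf _ _ le_rfl (by linarith) (by linarith))
          (hhalf _ _ (by linarith) le_rfl (by linarith)))
    _ = ENNReal.ofReal (4 / Γ.injConst * ρ) := by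
        rw [← ENNReal.ofReal_add (by positivity) (by positivity)]
        congr 1
        ring

end FiniteCurve

/-! ### The logarithmic bound of part (a) -/

section

open MeasureTheory Set

theorem intervalIntegral_inv_add_abs {d A : ℝ} (hd : 0 < d) (hA : 0 ≤ A) :
    ∫ x in (-A)..A, (d + |x|)⁻¹ = 2 * Real.log ((d + A) / d) := by
  have hc : Continuous fun x : ℝ => (d + |x|)⁻¹ :=
    (continuous_const.add continuous_abs).inv₀ fun x => (by positivity : (0 : ℝ) < d + |x|).ne'
  have h1 : ∫ x in (0 : ℝ)..A, (d + |x|)⁻¹ = Real.log ((d + A) / d) := by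
    have : ∫ x in (0 : ℝ)..A, (d + |x|)⁻¹ = ∫ x in (0 : ℝ)..A, (d + x)⁻¹ := by
      refine intervalIntegral.integral_congr fun x hx => ?_
      rw [uIcc_of_le hA] at hx
      simp only [abs_of_nonneg hx.1]
    rw [this, intervalIntegral.integral_comp_add_left (fun x => x⁻¹) d, add_zero,
      integral_inv_of_pos hd (by positivity)]
  have h2 : ∫ x in (-A)..0, (d + |x|)⁻¹ = ∫ x in (0 : ℝ)..A, (d + |x|)⁻¹ := by
    have := intervalIntegral.integral_comp_neg (fun x : ℝ => (d + |x|)⁻¹) (a := 0) (b := A)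
    simp only [abs_neg, neg_zero] at this
    exact this.symm
  rw [← intervalIntegral.integral_add_adjacent_intervals (b := 0) (hc.intervalIntegrable _ _)
    (hc.intervalIntegrable _ _), h2, h1]
  ring

theorem continuous_inv_add_abs_sub {d : ℝ} (hd : 0 < d) (c : ℝ) :
    Continuous fun x : ℝ => (d + |x - c|)⁻¹ :=
  (continuous_const.add (continuous_id.sub continuous_const).abs).inv₀ fun x =>
    (by positivity : (0 : ℝ) < d + |x - c|).ne'

theorem setIntegral_inv_add_abs_sub_le {d A a b c : ℝ} (hd : 0 < d) (hA : 0 ≤ A)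
    (ha : c - A ≤ a) (hb : b ≤ c + A) :
    ∫ x in Icc a b, (d + |x - c|)⁻¹ ≤ 2 * Real.log ((d + A) / d) := by
  have hc := continuous_inv_add_abs_sub hd c
  calc ∫ x in Icc a b, (d + |x - c|)⁻¹ ≤ ∫ x in Icc (c - A) (c + A), (d + |x - c|)⁻¹ := by
        refine setIntegral_mono_set (hc.integrableOn_Icc) ?_ (Icc_subset_Icc ha hb).eventuallyLE
        exact Filter.Eventually.of_forall fun x => by
          simp only [Pi.zero_apply]
          positivity
    _ = ∫ x in (c - A)..(c + A), (d + |x - c|)⁻¹ := by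
        rw [intervalIntegral.integral_of_le (by linarith), integral_Icc_eq_integral_Ioc]
    _ = ∫ x in (-A)..A, (d + |x|)⁻¹ := by
        rw [intervalIntegral.integral_comp_sub_right (fun x => (d + |x|)⁻¹) c]
        congr 1 <;> ring
    _ = _ := intervalIntegral_inv_add_abs hd hA

end

namespace FiniteCurve

open MeasureTheory Set

variable {Γ : FiniteCurve}

theorem delta₀_le (c : ℝ) : Γ.delta₀ c ≤ Γ.length / 2 := by
  unfold delta₀
  split_ifs
  · exact le_rfl
  · exact min_le_left _ _

/-- This is the purpose of `δ₀`: up to that arc length the Taylor error `Kh²` is at most a quarter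
of `(1 - |cos θ|)|h|`. -/
theorem maxCurvature_mul_le {c h : ℝ} (hc : |c| ≤ 1) (h1 : |h| ≤ Γ.delta₀ c) :
    Γ.maxCurvature * |h| ≤ (1 - |c|) / 4 := by
  unfold delta₀ at h1
  have hK := Γ.maxCurvature_nonneg
  split_ifs at h1 with h0
  · rw [h0, zero_mul]
    linarith
  · have h2 := h1.trans (min_le_right _ _)
    have hK' : 0 < Γ.maxCurvature := lt_of_le_of_ne hK (Ne.symm h0)
    have hM := Γ.chordArc_param_le_one (half_pos Γ.length_pos)
    calc Γ.maxCurvature * |h| ≤ Γ.maxCurvature *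
          (chordArc Γ.param Γ.length (Γ.length / 2) / (2 * Γ.maxCurvature) * ((1 - |c|) / 2)) :=
          mul_le_mul_of_nonneg_left h2 hK
      _ = chordArc Γ.param Γ.length (Γ.length / 2) * ((1 - |c|) / 4) := by
          field_simp
          ring
      _ ≤ 1 * ((1 - |c|) / 4) := mul_le_mul_of_nonneg_right hM (by linarith)
      _ = _ := one_mul _

/-- With `c = |⟨e, t⟩|`, the law of cosines gives `|de - ht|² ≥ d² + h² - 2cd|h| ≥ (1 - c)(d² +
h²)`, and `(1 - c)² ≤ 1 - c`. -/
theorem mul_max_le_norm_smul_sub {e t : Plane} (he : ‖e‖ = 1) (ht : ‖t‖ = 1) {d : ℝ} (hd : 0 ≤ d)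
    (h : ℝ) : (1 - |inner ℝ e t|) * max d |h| ≤ ‖d • e - h • t‖ := by
  have hc : |inner ℝ e t| ≤ 1 := by
    simpa [he, ht] using abs_real_inner_le_norm e t
  set c := |inner ℝ e t| with hcdef
  have hc0 : 0 ≤ c := abs_nonneg _
  have e1 : ‖d • e - h • t‖ ^ 2 = d ^ 2 - 2 * (d * h * inner ℝ e t) + h ^ 2 := by
    rw [norm_sub_sq_real, inner_smul_left, inner_smul_right, norm_smul, norm_smul, he, ht]
    simp
    ring
  have e2 : d * h * inner ℝ e t ≤ d * |h| * c := by
    refine (le_abs_self _).trans ?_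
    rw [abs_mul, abs_mul, abs_of_nonneg hd]
  refine le_of_sq_le_sq ?_ (norm_nonneg _)
  rw [e1, ← sq_abs h]
  have h0 := abs_nonneg h
  have e3 : (max d |h|) ^ 2 ≤ d ^ 2 + |h| ^ 2 := by
    rcases max_cases d |h| with ⟨h1, _⟩ | ⟨h1, _⟩ <;> rw [h1] <;> nlinarith
  have e4 : (1 - c) ^ 2 ≤ 1 - c := by nlinarith
  calc ((1 - c) * max d |h|) ^ 2 = (1 - c) ^ 2 * (max d |h|) ^ 2 := by ring
    _ ≤ (1 - c) * (d ^ 2 + |h| ^ 2) := by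
        refine mul_le_mul e4 e3 (by positivity) (by linarith)
    _ ≤ _ := by nlinarith [mul_nonneg hc0 (sq_nonneg (d - |h|))]

theorem exists_isArc_max_le_norm_sub {y e : Plane} {d s₀ s : ℝ} (he : ‖e‖ = 1)
    (hs₀ : s₀ ∈ Icc 0 Γ.length) (hd : 0 ≤ d) (hy : Γ.param s₀ = y - d • e)
    (hθ : |inner ℝ e (Γ.tangent s₀)| ≤ √3 / 2) (hb : d ≤ Γ.b₁ (inner ℝ e (Γ.tangent s₀)))
    (hs : s ∈ Icc 0 Γ.length) :
    ∃ h, Γ.IsArc s₀ s h ∧ Γ.injConst / 20 * max d |h| ≤ ‖y - Γ.param s‖ := by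
  obtain ⟨h, H, hM⟩ := Γ.exists_isArc_injConst_mul_le hs₀ hs
  refine ⟨h, H, ?_⟩
  have hM0 := Γ.injConst_pos
  have hM1 := Γ.injConst_le_one
  have ht := Γ.norm_tangent hs₀
  set c := inner ℝ e (Γ.tangent s₀) with hc
  have hm : 0 ≤ max d |h| := le_max_of_le_left hd
  -- Hence `1 - |c| ≥ 1/8`. After the Taylor error three quarters of it remain, and `3/32 ≥ 1/20`.
  have hsqrt : √3 ≤ 7 / 4 := by
    rw [Real.sqrt_le_left (by norm_num)]
    norm_num
  rcases le_or_gt |h| (Γ.delta₀ c) with h1 | h1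
  · have hK := maxCurvature_mul_le (by linarith) h1
    have hT := H.norm_sub_sub_le hs₀ hs
    have hU := mul_max_le_norm_smul_sub he ht hd h
    rw [← hc] at hU
    have e1 : d • e - h • Γ.tangent s₀ = (y - Γ.param s) +
        (Γ.param s - Γ.param s₀ - h • Γ.tangent s₀) := by
      rw [hy]
      module
    have e2 := norm_add_le (y - Γ.param s) (Γ.param s - Γ.param s₀ - h • Γ.tangent s₀)
    rw [← e1] at e2
    have e3 : Γ.maxCurvature * h ^ 2 ≤ (1 - |c|) / 4 * max d |h| := by
      rw [← sq_abs, sq, ← mul_assoc]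
      exact mul_le_mul hK (le_max_right _ _) (abs_nonneg _) (by linarith)
    have e4 : 1 / 20 * max d |h| ≤ (1 - |c|) * (3 / 4) * max d |h| :=
      mul_le_mul_of_nonneg_right (by linarith) hm
    have e5 : Γ.injConst / 20 * max d |h| ≤ 1 / 20 * max d |h| :=
      mul_le_mul_of_nonneg_right (by linarith) hm
    linarith
  -- Far along the curve, `2d ≤ Mδ₀ ≤ M|h|`, so subtracting `d` from the chord leaves at least
  -- `M|h|/2` and at least `d`.
  · have e1 : Γ.param s₀ - Γ.param s = (y - Γ.param s) - d • e := by
      rw [hy]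
      abel
    have e2 := norm_sub_le (y - Γ.param s) (d • e)
    rw [← e1, norm_smul, he, mul_one, Real.norm_eq_abs, abs_of_nonneg hd] at e2
    unfold b₁ at hb
    have e3 : Γ.injConst * Γ.delta₀ c ≤ Γ.injConst * |h| :=
      mul_le_mul_of_nonneg_left h1.le hM0.le
    rcases max_cases d |h| with ⟨h2, _⟩ | ⟨h2, _⟩ <;> rw [h2]
    · nlinarith
    · nlinarith [abs_nonneg h]

theorem logDistanceBound (Γ : FiniteCurve) :
    Γ.LogDistanceBound (160 / Γ.injConst) (80 / Γ.injConst) := by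
  intro y e d s₀ hyΓ he hs₀ hd hy _ hθ hb
  have hM0 := Γ.injConst_pos
  have hM1 := Γ.injConst_le_one
  have hL := Γ.length_pos
  have hd0 : 0 < d := by
    refine lt_of_le_of_ne hd fun h0 => hyΓ ⟨s₀, hs₀, ?_⟩
    rw [hy, ← h0, zero_smul, sub_zero]
  have hd1 : d ≤ 1 := hb.trans (min_le_left _ _)
  have hb1 := hb.trans (min_le_right _ _)
  have hdL : d ≤ Γ.length := by
    have h1 := delta₀_le (Γ := Γ) (inner ℝ e (Γ.tangent s₀))
    unfold b₁ at hb1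
    nlinarith
  -- One term for each possible signed arc length; summing all three avoids a choice depending on
  -- `s`. The factor 40 is `20 · 2`, from `d + |h| ≤ 2 max(d, |h|)`.
  set g : ℝ → ℝ := fun s => 40 / Γ.injConst * ((d + |s - s₀|)⁻¹ +
    (d + |s - (s₀ - Γ.length)|)⁻¹ + (d + |s - (s₀ + Γ.length)|)⁻¹) with hg
  have hint : ∀ c, IntegrableOn (fun s => (d + |s - c|)⁻¹) (Icc 0 Γ.length) := fun c =>
    (continuous_inv_add_abs_sub hd0 c).integrableOn_Icc
  have hgi : IntegrableOn g (Icc 0 Γ.length) :=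
    (((hint _).add (hint _)).add (hint _)).const_mul _
  have hpt : ∀ s ∈ Icc 0 Γ.length, 1 / ‖y - Γ.param s‖ ≤ g s := by
    intro s hs
    obtain ⟨h, H, hh⟩ := exists_isArc_max_le_norm_sub he hs₀ hd hy hθ hb1 hs
    have hm : 0 < max d |h| := lt_max_of_lt_left hd0
    have h1 : 1 / ‖y - Γ.param s‖ ≤ 40 / Γ.injConst * (d + |h|)⁻¹ := by
      have h2 : d + |h| ≤ 2 * max d |h| := by
        linarith [le_max_left d |h|, le_max_right d |h|]
      have h3 : 0 < Γ.injConst / 20 * max d |h| := by positivity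
      calc 1 / ‖y - Γ.param s‖ ≤ 1 / (Γ.injConst / 20 * max d |h|) :=
            one_div_le_one_div_of_le h3 hh
        _ = 40 / Γ.injConst * (2 * max d |h|)⁻¹ := by
            field_simp
            norm_num
        _ ≤ _ := by
            gcongr
    refine h1.trans (mul_le_mul_of_nonneg_left ?_ (by positivity))
    have p1 : 0 ≤ (d + |s - s₀|)⁻¹ := by positivity
    have p2 : 0 ≤ (d + |s - (s₀ - Γ.length)|)⁻¹ := by positivity
    have p3 : 0 ≤ (d + |s - (s₀ + Γ.length)|)⁻¹ := by positivity
    rcases H with rfl | ⟨_, rfl | rfl⟩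
    · linarith
    · rw [show s - s₀ + Γ.length = s - (s₀ - Γ.length) by ring]
      linarith
    · rw [show s - s₀ - Γ.length = s - (s₀ + Γ.length) by ring]
      linarith
  have hI : ∫ x, 1 / ‖y - x‖ ∂Γ.arcMeasure ≤
      40 / Γ.injConst * (6 * Real.log ((d + 2 * Γ.length) / d)) := by
    unfold arcMeasure
    rw [integral_map Γ.aemeasurable_param (by
      refine Measurable.aestronglyMeasurable ?_
      fun_prop)]
    calc ∫ s in Icc 0 Γ.length, 1 / ‖y - Γ.param s‖ ≤ ∫ s in Icc 0 Γ.length, g s := by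
          refine integral_mono_of_nonneg (Filter.Eventually.of_forall fun s => by
            simp only [Pi.zero_apply]; positivity) hgi ?_
          exact (ae_restrict_iff' measurableSet_Icc).2 (Filter.Eventually.of_forall hpt)
      _ = 40 / Γ.injConst * (∫ s in Icc 0 Γ.length, (d + |s - s₀|)⁻¹) +
          40 / Γ.injConst * (∫ s in Icc 0 Γ.length, (d + |s - (s₀ - Γ.length)|)⁻¹) +
          40 / Γ.injConst * (∫ s in Icc 0 Γ.length, (d + |s - (s₀ + Γ.length)|)⁻¹) := by
          have hadd : IntegrableOn (fun s => (d + |s - s₀|)⁻¹ + (d + |s - (s₀ - Γ.length)|)⁻¹)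
            (Icc 0 Γ.length) := (hint _).add (hint _)
          rw [hg, integral_const_mul, integral_add hadd (hint _), integral_add (hint _) (hint _)]
          ring
      _ ≤ 40 / Γ.injConst * (2 * Real.log ((d + 2 * Γ.length) / d)) +
          40 / Γ.injConst * (2 * Real.log ((d + 2 * Γ.length) / d)) +
          40 / Γ.injConst * (2 * Real.log ((d + 2 * Γ.length) / d)) := by
          have := hs₀.1
          have := hs₀.2
          gcongr <;> exact setIntegral_inv_add_abs_sub_le hd0 (by linarith) (by linarith)
            (by linarith)
      _ = _ := by ring
  have hlog : Real.log ((d + 2 * Γ.length) / d) ≤ 2 + (Real.log Γ.length + |Real.log d|) := by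
    have h3 : Real.log 3 ≤ 2 := by
      have := Real.log_le_sub_one_of_pos (show (0 : ℝ) < 3 by norm_num)
      linarith
    calc Real.log ((d + 2 * Γ.length) / d) ≤ Real.log (3 * Γ.length / d) := by
          refine Real.log_le_log (by positivity) ?_
          gcongr
          linarith
      _ = Real.log 3 + Real.log Γ.length - Real.log d := by
          rw [Real.log_div (by positivity) hd0.ne', Real.log_mul (by norm_num) hL.ne']
      _ ≤ _ := by linarith [neg_le_abs (Real.log d)]
  have hlog0 : 0 ≤ Real.log ((d + 2 * Γ.length) / d) := by
    refine Real.log_nonneg ?_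
    rw [le_div_iff₀ hd0]
    linarith
  have hpi := Real.pi_gt_three
  calc 1 / (2 * Real.pi) * ∫ x, 1 / ‖y - x‖ ∂Γ.arcMeasure
      ≤ 1 / (2 * Real.pi) * (40 / Γ.injConst * (6 * Real.log ((d + 2 * Γ.length) / d))) := by
        gcongr
    _ ≤ 1 / 6 * (40 / Γ.injConst * (6 * Real.log ((d + 2 * Γ.length) / d))) := by
        refine mul_le_mul_of_nonneg_right ?_ (by positivity)
        exact one_div_le_one_div_of_le (by norm_num) (by linarith)
    _ = 40 / Γ.injConst * Real.log ((d + 2 * Γ.length) / d) := by ring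
    -- The factor 40 would do here; it is doubled so that `2c₄ = 160/M` matches `40D` with `D = 4/M`
    -- in part (b).
    _ ≤ 80 / Γ.injConst * (2 + (Real.log Γ.length + |Real.log d|)) := by
        gcongr
        norm_num
    _ = _ := by ring

end FiniteCurve

/-! ### Trace inequality for smooth functions -/

open MeasureTheory Set Metric

open scoped ENNReal

theorem eLpNorm_two_sq {X E : Type*} [MeasurableSpace X] [NormedAddCommGroup E] (f : X → E)
    (μ : Measure X) : eLpNorm f 2 μ ^ 2 = ∫⁻ x, ‖f x‖ₑ ^ 2 ∂μ := by
  have := eLpNorm_nnreal_pow_eq_lintegral (f := f) (μ := μ) (p := 2) (by norm_num)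
  simpa using this

theorem volume_closedBall_eq (x : Plane) {ρ : ℝ} (hρ : 0 ≤ ρ) :
    volume (closedBall x ρ) = ENNReal.ofReal (ρ ^ 2 * Real.pi) := by
  rw [EuclideanSpace.volume_closedBall_fin_two, ← ENNReal.ofReal_pow hρ]
  rw [ENNReal.ofReal_mul (by positivity)]

theorem lintegral_comp_add_smul (F : Plane → ℝ≥0∞) (hF : Measurable F) (x : Plane) {ρ : ℝ}
    (hρ : 0 < ρ) :
    ∫⁻ w, F (x + ρ • w) = ENNReal.ofReal (ρ ^ 2)⁻¹ * ∫⁻ y, F y := by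
  have h1 : ∫⁻ w, F (x + ρ • w) = ∫⁻ y, F (x + y) ∂(Measure.map (fun w : Plane => ρ • w) volume) :=
    (lintegral_map (hF.comp (measurable_const_add x)) (measurable_const_smul ρ)).symm
  rw [h1, Measure.map_addHaar_smul volume hρ.ne', lintegral_smul_measure,
    lintegral_add_left_eq_self F x]
  simp [abs_of_pos hρ]

/-- Averages over discs, integrated against a measure `σ` for which the mass of discs is at most
linear in the radius. -/
theorem lintegral_lintegral_closedBall_le {σ : Measure Plane} [SFinite σ] {D : ℝ}
    (hσ : ∀ (x : Plane) (ρ : ℝ), 0 ≤ ρ → σ (closedBall x ρ) ≤ ENNReal.ofReal (D * ρ))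
    {F : Plane → ℝ≥0∞} (hF : Measurable F) {ρ : ℝ} (hρ : 0 < ρ) :
    ∫⁻ x, ∫⁻ w in closedBall (0 : Plane) 1, F (x + ρ • w) ∂volume ∂σ ≤
      ENNReal.ofReal (D / ρ) * ∫⁻ y, F y := by
  have h1 : ∀ x : Plane, ∫⁻ w in closedBall (0 : Plane) 1, F (x + ρ • w) =
      ENNReal.ofReal (ρ ^ 2)⁻¹ * ∫⁻ y, (closedBall x ρ).indicator F y := by
    intro x
    rw [← lintegral_comp_add_smul _ (hF.indicator measurableSet_closedBall) x hρ,
      ← lintegral_indicator measurableSet_closedBall]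
    refine lintegral_congr fun w => ?_
    by_cases hw : w ∈ closedBall (0 : Plane) 1
    · rw [indicator_of_mem hw, indicator_of_mem]
      rw [mem_closedBall_zero_iff] at hw
      rw [mem_closedBall, dist_eq_norm, add_sub_cancel_left, norm_smul, Real.norm_eq_abs,
        abs_of_pos hρ]
      nlinarith
    · rw [indicator_of_notMem hw, indicator_of_notMem]
      rw [mem_closedBall_zero_iff] at hw
      rw [mem_closedBall, dist_eq_norm, add_sub_cancel_left, norm_smul, Real.norm_eq_abs,
        abs_of_pos hρ]
      contrapose! hw
      exact le_of_mul_le_mul_left (by linarith) hρ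
  have hset : MeasurableSet {p : Plane × Plane | dist p.2 p.1 ≤ ρ} :=
    measurableSet_le (by fun_prop) measurable_const
  have hmeas : Measurable (Function.uncurry fun x y : Plane => (closedBall x ρ).indicator F y) := by
    have : (Function.uncurry fun x y : Plane => (closedBall x ρ).indicator F y) =
        {p : Plane × Plane | dist p.2 p.1 ≤ ρ}.indicator (fun p => F p.2) := by
      ext p
      by_cases hp : dist p.2 p.1 ≤ ρ
      · rw [indicator_of_mem (show p ∈ {p : Plane × Plane | dist p.2 p.1 ≤ ρ} from hp)]
        exact indicator_of_mem (show p.2 ∈ closedBall p.1 ρ from hp) _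
      · rw [indicator_of_notMem (show p ∉ {p : Plane × Plane | dist p.2 p.1 ≤ ρ} from hp)]
        exact indicator_of_notMem (show p.2 ∉ closedBall p.1 ρ from hp) _
    rw [this]
    exact (hF.comp measurable_snd).indicator hset
  calc ∫⁻ x, ∫⁻ w in closedBall (0 : Plane) 1, F (x + ρ • w) ∂volume ∂σ
      = ENNReal.ofReal (ρ ^ 2)⁻¹ * ∫⁻ x, ∫⁻ y, (closedBall x ρ).indicator F y ∂volume ∂σ := by
        simp_rw [h1]
        rw [lintegral_const_mul]
        exact hmeas.lintegral_prod_right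
    _ = ENNReal.ofReal (ρ ^ 2)⁻¹ * ∫⁻ y, F y * σ (closedBall y ρ) := by
        rw [lintegral_lintegral_swap hmeas.aemeasurable]
        congr 1
        refine lintegral_congr fun y => ?_
        rw [← lintegral_indicator_const measurableSet_closedBall]
        refine lintegral_congr fun x => ?_
        by_cases hx : x ∈ closedBall y ρ
        · rw [indicator_of_mem hx, indicator_of_mem (mem_closedBall_comm.1 hx)]
        · rw [indicator_of_notMem hx, indicator_of_notMem (mt mem_closedBall_comm.1 hx)]
    _ ≤ ENNReal.ofReal (ρ ^ 2)⁻¹ * ∫⁻ y, F y * ENNReal.ofReal (D * ρ) := by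
        gcongr with y
        exact hσ y ρ hρ.le
    _ = ENNReal.ofReal (D / ρ) * ∫⁻ y, F y := by
        rw [lintegral_mul_const _ hF, mul_comm (∫⁻ y, F y), ← mul_assoc,
          ← ENNReal.ofReal_mul (by positivity)]
        congr 2
        field_simp

/-- The variance of `f` on the unit interval is nonnegative. -/
theorem sq_integral_le_integral_sq {f : ℝ → ℝ} (hf : Continuous f) :
    (∫ t in (0 : ℝ)..1, f t) ^ 2 ≤ ∫ t in (0 : ℝ)..1, f t ^ 2 := by
  set c := ∫ t in (0 : ℝ)..1, f t with hc
  have h0 : 0 ≤ ∫ t in (0 : ℝ)..1, (f t - c) ^ 2 :=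
    intervalIntegral.integral_nonneg (by norm_num) fun t _ => sq_nonneg _
  have h1 : ∫ t in (0 : ℝ)..1, (f t - c) ^ 2 = (∫ t in (0 : ℝ)..1, f t ^ 2) - c ^ 2 := by
    have e : ∀ t, (f t - c) ^ 2 = f t ^ 2 - (2 * c) * f t + c ^ 2 := fun t => by ring
    simp_rw [e]
    have i1 : IntervalIntegrable (fun t => f t ^ 2) volume 0 1 := (hf.pow 2).intervalIntegrable _ _
    have i2 : IntervalIntegrable (fun t => 2 * c * f t) volume 0 1 :=
      (continuous_const.mul hf).intervalIntegrable _ _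
    rw [intervalIntegral.integral_add (i1.sub i2) intervalIntegrable_const,
      intervalIntegral.integral_sub i1 i2, intervalIntegral.integral_const_mul, ← hc]
    simp
    ring
  linarith

/-- The segment from `x` to `x + rw` is run through as `x + t²rw`. Averaging over discs of radius
`ρ` against `σ` will cost `D/ρ`. At linear speed this leaves a divergent `∫ dt/t`, while here the
weight `t²` cancels the `1/t²`. -/
theorem norm_sq_le_add_integral {u : Plane → ℂ} (hu : ContDiff ℝ 1 u) (x : Plane) {w : Plane}
    (hw : ‖w‖ ≤ 1) {r : ℝ} (hr : 0 ≤ r) :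
    ‖u x‖ ^ 2 ≤ 2 * ‖u (x + r • w)‖ ^ 2 +
      ∫ t in (0 : ℝ)..1, 8 * r ^ 2 * t ^ 2 * ‖fderiv ℝ u (x + (t ^ 2 * r) • w)‖ ^ 2 := by
  have hcd : Continuous (fderiv ℝ u) := hu.continuous_fderiv one_ne_zero
  have hpath : Continuous fun t : ℝ => x + (t ^ 2 * r) • w := by fun_prop
  have hc1 : Continuous fun t : ℝ => fderiv ℝ u (x + (t ^ 2 * r) • w) := hcd.comp hpath
  have hd : ∀ t : ℝ, HasDerivAt (fun t : ℝ => u (x + (t ^ 2 * r) • w))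
      (fderiv ℝ u (x + (t ^ 2 * r) • w) ((2 * t * r) • w)) t := by
    intro t
    have h1 : HasDerivAt (fun t : ℝ => x + (t ^ 2 * r) • w) ((2 * t * r) • w) t := by
      have := (((hasDerivAt_pow 2 t).mul_const r).smul_const w).const_add x
      simpa using this
    exact ((hu.differentiable one_ne_zero _).hasFDerivAt).comp_hasDerivAt t h1
  have hc2 : Continuous fun t : ℝ => fderiv ℝ u (x + (t ^ 2 * r) • w) ((2 * t * r) • w) :=
    hc1.clm_apply (by fun_prop)
  have hftc := intervalIntegral.integral_eq_sub_of_hasDerivAt (a := 0) (b := 1)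
    (fun t _ => hd t) (hc2.intervalIntegrable _ _)
  simp only [one_pow, one_mul, zero_pow two_ne_zero, zero_mul, zero_smul, add_zero] at hftc
  set g : ℝ → ℝ := fun t => 2 * t * r * ‖fderiv ℝ u (x + (t ^ 2 * r) • w)‖ with hg
  have hgc : Continuous g := by
    have := hc1.norm
    fun_prop
  have hle : ‖∫ t in (0 : ℝ)..1, fderiv ℝ u (x + (t ^ 2 * r) • w) ((2 * t * r) • w)‖ ≤
      ∫ t in (0 : ℝ)..1, g t := by
    refine intervalIntegral.norm_integral_le_of_norm_le (by norm_num) ?_ (hgc.intervalIntegrable _ _)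
    refine Filter.Eventually.of_forall fun t ht => ?_
    refine (ContinuousLinearMap.le_opNorm _ _).trans ?_
    rw [norm_smul, Real.norm_eq_abs, abs_of_nonneg (by have := ht.1; positivity), hg]
    have h0 := norm_nonneg (fderiv ℝ u (x + (t ^ 2 * r) • w))
    have h1 : 2 * t * r * ‖w‖ ≤ 2 * t * r :=
      mul_le_of_le_one_right (by have := ht.1; positivity) hw
    nlinarith
  rw [hftc] at hle
  have h2 : ‖u x‖ ≤ ‖u (x + r • w)‖ + ∫ t in (0 : ℝ)..1, g t := by
    have := norm_sub_norm_le (u x) (u (x + r • w))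
    rw [norm_sub_rev] at this
    linarith
  have h3 := sq_integral_le_integral_sq hgc
  have h4 : ∫ t in (0 : ℝ)..1, 8 * r ^ 2 * t ^ 2 * ‖fderiv ℝ u (x + (t ^ 2 * r) • w)‖ ^ 2 =
      2 * ∫ t in (0 : ℝ)..1, g t ^ 2 := by
    rw [← intervalIntegral.integral_const_mul]
    congr 1
    ext t
    rw [hg]
    ring
  rw [h4]
  have h5 := norm_nonneg (u x)
  have h6 := norm_nonneg (u (x + r • w))
  nlinarith [sq_nonneg (‖u (x + r • w)‖ - ∫ t in (0 : ℝ)..1, g t)]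

theorem enorm_sq_le_add_lintegral {u : Plane → ℂ} (hu : ContDiff ℝ 1 u) (x : Plane) {w : Plane}
    (hw : ‖w‖ ≤ 1) {r : ℝ} (hr : 0 ≤ r) :
    ‖u x‖ₑ ^ 2 ≤ 2 * ‖u (x + r • w)‖ₑ ^ 2 +
      ∫⁻ t in Ioc (0 : ℝ) 1, ENNReal.ofReal (8 * r ^ 2 * t ^ 2) *
        ‖fderiv ℝ u (x + (t ^ 2 * r) • w)‖ₑ ^ 2 := by
  have hcd : Continuous (fderiv ℝ u) := hu.continuous_fderiv one_ne_zero
  have hpath : Continuous fun t : ℝ => x + (t ^ 2 * r) • w := by fun_prop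
  have hc1 : Continuous fun t : ℝ => ‖fderiv ℝ u (x + (t ^ 2 * r) • w)‖ := (hcd.comp hpath).norm
  have hc : Continuous fun t : ℝ => 8 * r ^ 2 * t ^ 2 * ‖fderiv ℝ u (x + (t ^ 2 * r) • w)‖ ^ 2 := by
    fun_prop
  have h := ENNReal.ofReal_le_ofReal (norm_sq_le_add_integral hu x hw hr)
  rw [ENNReal.ofReal_add (by positivity) (intervalIntegral.integral_nonneg (by norm_num)
    fun t _ => by positivity), intervalIntegral.integral_of_le (by norm_num),
    ofReal_integral_eq_lintegral_ofReal hc.integrableOn_Ioc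
      (Filter.Eventually.of_forall fun t => by simp only [Pi.zero_apply]; positivity),
    ENNReal.ofReal_mul (by norm_num), ENNReal.ofReal_pow (norm_nonneg _),
    ENNReal.ofReal_pow (norm_nonneg _), ofReal_norm, ofReal_norm] at h
  convert h using 2
  · simp
  · refine lintegral_congr fun t => ?_
    rw [ENNReal.ofReal_mul (q := ‖fderiv ℝ u (x + (t ^ 2 * r) • w)‖ ^ 2) (by positivity),
      ENNReal.ofReal_pow (norm_nonneg _), ofReal_norm]

theorem lintegral_lintegral_lintegral_comm {X Y Z : Type*} [MeasurableSpace X] [MeasurableSpace Y]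
    [MeasurableSpace Z] (μ : Measure X) (ν : Measure Y) (τ : Measure Z) [SFinite μ] [SFinite ν]
    [SFinite τ] {H : X → Y → Z → ℝ≥0∞}
    (hH : Measurable fun p : (X × Y) × Z => H p.1.1 p.1.2 p.2) :
    ∫⁻ x, ∫⁻ y, ∫⁻ z, H x y z ∂τ ∂ν ∂μ = ∫⁻ z, ∫⁻ x, ∫⁻ y, H x y z ∂ν ∂μ ∂τ := by
  have hH' : Measurable fun p : (X × Z) × Y => H p.1.1 p.2 p.1.2 :=
    hH.comp (f := fun p : (X × Z) × Y => ((p.1.1, p.2), p.1.2)) (by fun_prop)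
  have h1 : Measurable fun p : X × Z => ∫⁻ y, H p.1 y p.2 ∂ν := hH'.lintegral_prod_right'
  rw [← lintegral_lintegral_swap (f := fun x z => ∫⁻ y, H x y z ∂ν) h1.aemeasurable]
  refine lintegral_congr fun x => lintegral_lintegral_swap ?_
  have h2 : Measurable fun p : Y × Z => H x p.1 p.2 :=
    hH.comp (f := fun p : Y × Z => ((x, p.1), p.2)) (by fun_prop)
  exact h2.aemeasurable

theorem lintegral_lintegral_add {X Y : Type*} [MeasurableSpace X] [MeasurableSpace Y]
    (μ : Measure X) (ν : Measure Y) [SFinite ν] {F G : X → Y → ℝ≥0∞}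
    (hF : Measurable fun p : X × Y => F p.1 p.2) :
    ∫⁻ x, ∫⁻ y, (F x y + G x y) ∂ν ∂μ =
      (∫⁻ x, ∫⁻ y, F x y ∂ν ∂μ) + ∫⁻ x, ∫⁻ y, G x y ∂ν ∂μ := by
  have h1 : Measurable fun x => ∫⁻ y, F x y ∂ν := hF.lintegral_prod_right'
  rw [← lintegral_add_left h1]
  refine lintegral_congr fun x => lintegral_add_left ?_ _
  exact hF.comp (f := fun y => (x, y)) (by fun_prop)

/-- The trace inequality for a measure for which the mass of discs is at most linear in the
radius. -/
theorem lintegral_enorm_sq_le {σ : Measure Plane} [SFinite σ] {D : ℝ}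
    (hσ : ∀ (x : Plane) (ρ : ℝ), 0 ≤ ρ → σ (closedBall x ρ) ≤ ENNReal.ofReal (D * ρ))
    {u : Plane → ℂ} (hu : ContDiff ℝ 1 u) {r : ℝ} (hr : 0 < r) :
    ∫⁻ x, ‖u x‖ₑ ^ 2 ∂σ ≤ ENNReal.ofReal (2 * D / r) * (∫⁻ y, ‖u y‖ₑ ^ 2) +
      ENNReal.ofReal (8 * D * r) * ∫⁻ y, ‖fderiv ℝ u y‖ₑ ^ 2 := by
  set B := closedBall (0 : Plane) 1 with hB
  have hBm : MeasurableSet B := measurableSet_closedBall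
  have hB1 : 1 ≤ volume B := by
    rw [hB, volume_closedBall_eq _ zero_le_one, ENNReal.one_le_ofReal]
    linarith [Real.pi_gt_three]
  have hcd : Continuous (fderiv ℝ u) := hu.continuous_fderiv one_ne_zero
  have hm1 : Measurable fun y => ‖u y‖ₑ ^ 2 := hu.continuous.enorm.measurable.pow_const 2
  have hm2 : Measurable fun y => ‖fderiv ℝ u y‖ₑ ^ 2 := hcd.enorm.measurable.pow_const 2
  set H : Plane → Plane → ℝ → ℝ≥0∞ := fun x w t => ENNReal.ofReal (8 * r ^ 2 * t ^ 2) *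
        ‖fderiv ℝ u (x + (t ^ 2 * r) • w)‖ₑ ^ 2 with hH
  have hHm : Measurable fun p : (Plane × Plane) × ℝ => H p.1.1 p.1.2 p.2 := by
    refine Measurable.mul (by fun_prop) (hm2.comp ?_)
    exact Continuous.measurable (by fun_prop)
  -- The unit disc has area `π ≥ 1`, so integrating over directions `w` without normalizing only
  -- increases the left side.
  calc ∫⁻ x, ‖u x‖ₑ ^ 2 ∂σ ≤ ∫⁻ x, ∫⁻ _ in B, ‖u x‖ₑ ^ 2 ∂volume ∂σ := by
        refine lintegral_mono fun x => ?_
        rw [setLIntegral_const]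
        exact le_mul_of_one_le_right' hB1
    _ ≤ ∫⁻ x, ∫⁻ w in B, (2 * ‖u (x + r • w)‖ₑ ^ 2 + ∫⁻ t in Ioc (0 : ℝ) 1, H x w t) ∂volume ∂σ := by
        refine lintegral_mono fun x => setLIntegral_mono' hBm fun w hw => ?_
        exact enorm_sq_le_add_lintegral hu x (mem_closedBall_zero_iff.1 hw) hr.le
    _ = (∫⁻ x, ∫⁻ w in B, 2 * ‖u (x + r • w)‖ₑ ^ 2 ∂volume ∂σ) +
          ∫⁻ x, ∫⁻ w in B, ∫⁻ t in Ioc (0 : ℝ) 1, H x w t ∂volume ∂volume ∂σ := by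
        have hmm : Measurable fun p : Plane × Plane => 2 * ‖u (p.1 + r • p.2)‖ₑ ^ 2 :=
          (hm1.comp (Continuous.measurable (f := fun p : Plane × Plane => p.1 + r • p.2)
            (by fun_prop))).const_mul 2
        exact lintegral_lintegral_add σ (volume.restrict B) hmm
    _ = 2 * (∫⁻ x, ∫⁻ w in B, ‖u (x + r • w)‖ₑ ^ 2 ∂volume ∂σ) +
          ∫⁻ t in Ioc (0 : ℝ) 1, ∫⁻ x, ∫⁻ w in B, H x w t ∂volume ∂σ ∂volume := by
        congr 1
        · rw [← lintegral_const_mul']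
          · refine lintegral_congr fun x => ?_
            rw [lintegral_const_mul' _ _ (by norm_num)]
          · norm_num
        · exact lintegral_lintegral_lintegral_comm σ (volume.restrict B) _ hHm
    _ ≤ 2 * (ENNReal.ofReal (D / r) * ∫⁻ y, ‖u y‖ₑ ^ 2) +
          ∫⁻ t in Ioc (0 : ℝ) 1, ENNReal.ofReal (8 * D * r) * ∫⁻ y, ‖fderiv ℝ u y‖ₑ ^ 2 := by
        refine add_le_add (mul_le_mul_right (lintegral_lintegral_closedBall_le hσ hm1 hr) 2) ?_
        refine setLIntegral_mono' measurableSet_Ioc fun t ht => ?_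
        have ht0 := ht.1
        have hρ : 0 < t ^ 2 * r := by positivity
        calc ∫⁻ x, ∫⁻ w in B, H x w t ∂volume ∂σ = ENNReal.ofReal (8 * r ^ 2 * t ^ 2) *
              ∫⁻ x, ∫⁻ w in B, ‖fderiv ℝ u (x + (t ^ 2 * r) • w)‖ₑ ^ 2 ∂volume ∂σ := by
              rw [← lintegral_const_mul' _ _ ENNReal.ofReal_ne_top]
              refine lintegral_congr fun x => ?_
              rw [← lintegral_const_mul' _ _ ENNReal.ofReal_ne_top]
          _ ≤ ENNReal.ofReal (8 * r ^ 2 * t ^ 2) *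
              (ENNReal.ofReal (D / (t ^ 2 * r)) * ∫⁻ y, ‖fderiv ℝ u y‖ₑ ^ 2) :=
              mul_le_mul_right (lintegral_lintegral_closedBall_le hσ hm2 hρ) _
          _ = _ := by
              rw [← mul_assoc, ← ENNReal.ofReal_mul (by positivity)]
              congr 2
              field_simp
    _ = _ := by
        rw [setLIntegral_const, Real.volume_Ioc, sub_zero, ENNReal.ofReal_one, mul_one, ← mul_assoc,
          mul_div_assoc, ENNReal.ofReal_mul (p := 2) (by norm_num)]
        simp

/-! ### Trace inequality in the Sobolev space and energy estimate -/

open MeasureTheory Set Metric Filter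

open scoped ENNReal Topology

section Norms

variable {X E : Type*} [MeasurableSpace X] [NormedAddCommGroup E] {μ : Measure X}

theorem tendsto_eLpNorm_of_tendsto_sub {φ : ℕ → X → E} {f : X → E}
    (hφ : ∀ n, AEStronglyMeasurable (φ n) μ) (hf : MemLp f 2 μ)
    (h : Tendsto (fun n => eLpNorm (fun x => φ n x - f x) 2 μ) atTop (𝓝 0)) :
    Tendsto (fun n => eLpNorm (φ n) 2 μ) atTop (𝓝 (eLpNorm f 2 μ)) := by
  have h1 : ∀ n, eLpNorm (φ n) 2 μ ≤ eLpNorm f 2 μ + eLpNorm (fun x => φ n x - f x) 2 μ := by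
    intro n
    have := eLpNorm_add_le hf.1 ((hφ n).sub hf.1) (one_le_two)
    rwa [add_sub_cancel] at this
  have h2 : ∀ n, eLpNorm f 2 μ - eLpNorm (fun x => φ n x - f x) 2 μ ≤ eLpNorm (φ n) 2 μ := by
    intro n
    rw [tsub_le_iff_right]
    have := eLpNorm_sub_le (hφ n) ((hφ n).sub hf.1) (one_le_two)
    rwa [sub_sub_cancel] at this
  refine tendsto_of_tendsto_of_tendsto_of_le_of_le ?_ ?_ h2 h1
  · simpa using ENNReal.Tendsto.sub tendsto_const_nhds h (Or.inl hf.2.ne)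
  · simpa using tendsto_const_nhds.add h

theorem ofReal_integral_norm_sq {f : X → E} (hf : MemLp f 2 μ) :
    ENNReal.ofReal (∫ x, ‖f x‖ ^ 2 ∂μ) = eLpNorm f 2 μ ^ 2 := by
  rw [eLpNorm_two_sq, ofReal_integral_eq_lintegral_ofReal hf.norm.integrable_sq
    (Eventually.of_forall fun x => by simp only [Pi.zero_apply]; positivity)]
  refine lintegral_congr fun x => ?_
  rw [ENNReal.ofReal_pow (norm_nonneg _), ofReal_norm]

end Norms

theorem IsTestFunction.continuous {φ : Plane → ℂ} (h : IsTestFunction φ) : Continuous φ :=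
  h.1.continuous

theorem IsTestFunction.partialDeriv {φ : Plane → ℂ} (h : IsTestFunction φ) (i : Fin 2) :
    IsTestFunction (partialDeriv i φ) := by
  refine ⟨(h.1.fderiv_right (m := ∞) (by norm_cast)).clm_apply contDiff_const, ?_⟩
  exact (h.2.fderiv_apply (𝕜 := ℝ) _)

theorem norm_fderiv_le_sum (u : Plane → ℂ) (y : Plane) :
    ‖fderiv ℝ u y‖ ≤ ∑ i, ‖partialDeriv i u y‖ := by
  refine ContinuousLinearMap.opNorm_le_bound _ (Finset.sum_nonneg fun i _ => norm_nonneg _)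
    fun v => ?_
  have hv : v = ∑ i, v i • EuclideanSpace.single i (1 : ℝ) := by
    ext j
    fin_cases j <;> simp
  conv_lhs => rw [hv]
  rw [map_sum, Finset.sum_mul]
  refine (norm_sum_le _ _).trans (Finset.sum_le_sum fun i _ => ?_)
  rw [map_smul, norm_smul, mul_comm]
  exact mul_le_mul_of_nonneg_left (PiLp.norm_apply_le v i) (norm_nonneg _)

theorem lintegral_enorm_fderiv_sq_le {u : Plane → ℂ} (hu : IsTestFunction u) :
    ∫⁻ y, ‖fderiv ℝ u y‖ₑ ^ 2 ≤ 2 * ∑ i, eLpNorm (partialDeriv i u) 2 volume ^ 2 := by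
  simp_rw [eLpNorm_two_sq]
  have hm : ∀ i, Measurable fun y => ‖partialDeriv i u y‖ₑ ^ 2 := fun i =>
    (hu.partialDeriv i).continuous.enorm.measurable.pow_const 2
  rw [← lintegral_finsetSum _ fun i _ => hm i, ← lintegral_const_mul' _ _ (by norm_num)]
  refine lintegral_mono fun y => ?_
  have h1 : ‖fderiv ℝ u y‖ ^ 2 ≤ 2 * ∑ i, ‖partialDeriv i u y‖ ^ 2 := by
    have h := norm_fderiv_le_sum u y
    rw [Fin.sum_univ_two] at h ⊢
    have h0 := norm_nonneg (fderiv ℝ u y)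
    nlinarith [sq_nonneg (‖partialDeriv 0 u y‖ - ‖partialDeriv 1 u y‖)]
  have h2 := ENNReal.ofReal_le_ofReal h1
  rw [ENNReal.ofReal_mul (by norm_num), ENNReal.ofReal_sum_of_nonneg fun i _ => by positivity,
    ENNReal.ofReal_pow (norm_nonneg _), ofReal_norm] at h2
  simpa [ENNReal.ofReal_pow, ofReal_norm] using h2

section Trace

variable {σ : Measure Plane} [SFinite σ] {D : ℝ} {u tr : Plane → ℂ} {g : Fin 2 → Plane → ℂ}

theorem IsTrace.eLpNorm_sq_le (ht : IsTrace σ u g tr) (hu : HasSobolevGradient u g) (hD : 0 ≤ D)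
    (hσ : ∀ (x : Plane) (ρ : ℝ), 0 ≤ ρ → σ (closedBall x ρ) ≤ ENNReal.ofReal (D * ρ))
    {r : ℝ} (hr : 0 < r) :
    eLpNorm tr 2 σ ^ 2 ≤ ENNReal.ofReal (2 * D / r) * eLpNorm u 2 volume ^ 2 +
      ENNReal.ofReal (16 * D * r) * ∑ i, eLpNorm (g i) 2 volume ^ 2 := by
  obtain ⟨φ, hφ, h1, h2, h3⟩ := ht.approx
  have e1 := tendsto_eLpNorm_of_tendsto_sub (fun n => (hφ n).continuous.aestronglyMeasurable)
    hu.memLp h1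
  have e2 := fun i => tendsto_eLpNorm_of_tendsto_sub
    (fun n => ((hφ n).partialDeriv i).continuous.aestronglyMeasurable) (hu.memLp_grad i) (h2 i)
  have e3 := tendsto_eLpNorm_of_tendsto_sub (fun n => (hφ n).continuous.aestronglyMeasurable)
    ht.memLp h3
  refine le_of_tendsto_of_tendsto' (ENNReal.Tendsto.pow e3) (((ENNReal.Tendsto.const_mul (ENNReal.Tendsto.pow e1)
    (Or.inr ENNReal.ofReal_ne_top))).add (ENNReal.Tendsto.const_mul
      (tendsto_finsetSum _ fun i _ => ENNReal.Tendsto.pow (e2 i)) (Or.inr ENNReal.ofReal_ne_top))) fun n => ?_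
  have h := lintegral_enorm_sq_le hσ ((hφ n).1.of_le (by norm_cast)) hr
  rw [← eLpNorm_two_sq, ← eLpNorm_two_sq] at h
  refine h.trans (add_le_add le_rfl ?_)
  refine (mul_le_mul_right (lintegral_enorm_fderiv_sq_le (hφ n)) _).trans ?_
  rw [← mul_assoc]
  refine mul_le_mul_left ?_ _
  rw [show (2 : ℝ≥0∞) = ENNReal.ofReal 2 by simp, ← ENNReal.ofReal_mul (by positivity)]
  exact ENNReal.ofReal_le_ofReal (by linarith)

theorem IsTrace.integral_norm_sq_le (ht : IsTrace σ u g tr) (hu : HasSobolevGradient u g)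
    (hD : 0 ≤ D)
    (hσ : ∀ (x : Plane) (ρ : ℝ), 0 ≤ ρ → σ (closedBall x ρ) ≤ ENNReal.ofReal (D * ρ))
    {r : ℝ} (hr : 0 < r) :
    ∫ x, ‖tr x‖ ^ 2 ∂σ ≤ 2 * D / r * (∫ x, ‖u x‖ ^ 2) + 16 * D * r * ∑ i, ∫ x, ‖g i x‖ ^ 2 := by
  have h := ht.eLpNorm_sq_le hu hD hσ hr
  have hn : ∀ i, 0 ≤ ∫ x, ‖g i x‖ ^ 2 := fun i => integral_nonneg fun x => by positivity
  have hn' : 0 ≤ ∫ x, ‖u x‖ ^ 2 := integral_nonneg fun x => by positivity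
  rw [← ofReal_integral_norm_sq ht.memLp, ← ofReal_integral_norm_sq hu.memLp] at h
  simp_rw [← ofReal_integral_norm_sq (hu.memLp_grad _)] at h
  rw [← ENNReal.ofReal_sum_of_nonneg fun i _ => hn i, ← ENNReal.ofReal_mul (by positivity),
    ← ENNReal.ofReal_mul (by positivity), ← ENNReal.ofReal_add
      (mul_nonneg (by positivity) hn')
      (mul_nonneg (by positivity) (Finset.sum_nonneg fun i _ => hn i))] at h
  refine (ENNReal.ofReal_le_ofReal_iff ?_).1 h
  exact add_nonneg (mul_nonneg (by positivity) hn')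
      (mul_nonneg (by positivity) (Finset.sum_nonneg fun i _ => hn i))

end Trace

theorem integral_mul_conj_self {X : Type*} [MeasurableSpace X] (μ : Measure X) (f : X → ℂ) :
    ∫ x, f x * (starRingEnd ℂ) (f x) ∂μ = ((∫ x, ‖f x‖ ^ 2 ∂μ : ℝ) : ℂ) := by
  rw [← integral_complex_ofReal]
  refine integral_congr_ae (Eventually.of_forall fun x => ?_)
  simp only [Complex.mul_conj, Complex.normSq_eq_norm_sq]

/-- The energy identity for an eigenfunction. -/
theorem energy_identity {σ : Measure Plane} {α κ : ℝ} {ψ tψ : Plane → ℂ}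
    {gψ : Fin 2 → Plane → ℂ} (hg : ∀ i, MemLp (gψ i) 2)
    (h : form σ α gψ tψ gψ tψ = ∫ x, ((-κ ^ 2 : ℝ) : ℂ) * ψ x * (starRingEnd ℂ) (ψ x)) :
    (∑ i, ∫ x, ‖gψ i x‖ ^ 2) + κ ^ 2 * ∫ x, ‖ψ x‖ ^ 2 = α * ∫ x, ‖tψ x‖ ^ 2 ∂σ := by
  unfold form at h
  rw [integral_finsetSum _ fun i _ => ?_] at h
  · simp_rw [mul_assoc, integral_const_mul, integral_mul_conj_self] at h
    have h' : ((((∑ i, ∫ x, ‖gψ i x‖ ^ 2) - α * ∫ x, ‖tψ x‖ ^ 2 ∂σ : ℝ)) : ℂ) =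
        ((-κ ^ 2 * ∫ x, ‖ψ x‖ ^ 2 : ℝ) : ℂ) := by
      push_cast
      push_cast at h
      exact h
    have := Complex.ofReal_injective h'
    linarith
  · have := (hg i).norm.integrable_sq
    refine (this.ofReal (𝕜 := ℂ)).congr (Eventually.of_forall fun x => ?_)
    simp only [Complex.mul_conj, Complex.normSq_eq_norm_sq]
    rfl

/-- The energy identity bounds the gradient by `α` times the trace. For `32Dαr ≤ 1` the gradient
term of the trace inequality is then at most half the trace and is absorbed on the left. -/
theorem integral_norm_sq_trace_le {σ : Measure Plane} [SFinite σ] {D α κ r : ℝ} {ψ tψ : Plane → ℂ}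
    {gψ : Fin 2 → Plane → ℂ} (ht : IsTrace σ ψ gψ tψ) (hu : HasSobolevGradient ψ gψ) (hD : 0 ≤ D)
    (hσ : ∀ (x : Plane) (ρ : ℝ), 0 ≤ ρ → σ (closedBall x ρ) ≤ ENNReal.ofReal (D * ρ))
    (hr : 0 < r) (hrα : 32 * D * α * r ≤ 1)
    (h : form σ α gψ tψ gψ tψ = ∫ x, ((-κ ^ 2 : ℝ) : ℂ) * ψ x * (starRingEnd ℂ) (ψ x)) :
    ∫ x, ‖tψ x‖ ^ 2 ∂σ ≤ 4 * D / r * ∫ x, ‖ψ x‖ ^ 2 := by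
  have h1 := ht.integral_norm_sq_le hu hD hσ hr
  have h2 := energy_identity hu.memLp_grad h
  have h3 : 0 ≤ ∫ x, ‖ψ x‖ ^ 2 := integral_nonneg fun x => by positivity
  have h4 : 0 ≤ ∫ x, ‖tψ x‖ ^ 2 ∂σ := integral_nonneg fun x => by positivity
  have h5 : 16 * D * r * ∑ i, ∫ x, ‖gψ i x‖ ^ 2 ≤ 16 * D * r * (α * ∫ x, ‖tψ x‖ ^ 2 ∂σ) := by
    refine mul_le_mul_of_nonneg_left ?_ (by positivity)
    nlinarith [mul_nonneg (sq_nonneg κ) h3]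
  have h6 : 16 * D * r * (α * ∫ x, ‖tψ x‖ ^ 2 ∂σ) ≤ 1 / 2 * ∫ x, ‖tψ x‖ ^ 2 ∂σ := by
    nlinarith
  have h7 : 4 * D / r * ∫ x, ‖ψ x‖ ^ 2 = 2 * (2 * D / r * ∫ x, ‖ψ x‖ ^ 2) := by ring
  linarith

/-! ### Truncated logarithmic kernel -/

/-- A smooth nondecreasing function which vanishes up to `1 / 2` and equals `1` from `1` on. -/
def transition (s : ℝ) : ℝ := Real.smoothTransition (2 * s - 1)

theorem contDiff_transition : ContDiff ℝ ∞ transition :=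
  Real.smoothTransition.contDiff.comp ((contDiff_const.mul contDiff_id).sub contDiff_const)

theorem hasDerivAt_transition (s : ℝ) : HasDerivAt transition (deriv transition s) s :=
  (contDiff_transition.differentiable (by norm_num) s).hasDerivAt

theorem monotone_transition : Monotone transition := fun a b h =>
  Real.smoothTransition.monotone (by linarith)

theorem transition_nonneg (s : ℝ) : 0 ≤ transition s := Real.smoothTransition.nonneg _

theorem transition_le_one (s : ℝ) : transition s ≤ 1 := Real.smoothTransition.le_one _

theorem transition_of_le {s : ℝ} (h : s ≤ 1 / 2) : transition s = 0 :=
  Real.smoothTransition.zero_of_nonpos (by linarith)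

theorem transition_of_ge {s : ℝ} (h : 1 ≤ s) : transition s = 1 :=
  Real.smoothTransition.one_of_one_le (by linarith)

theorem continuous_deriv_transition : Continuous (deriv transition) :=
  contDiff_transition.continuous_deriv (by norm_cast)

theorem deriv_transition_nonneg (s : ℝ) : 0 ≤ deriv transition s :=
  monotone_transition.deriv_nonneg

theorem deriv_transition_of_ge {s : ℝ} (h : 1 ≤ s) : deriv transition s = 0 := by
  refine IsLocalMax.deriv_eq_zero (Eventually.of_forall fun t => ?_)
  rw [transition_of_ge h]
  exact transition_le_one t

theorem exists_deriv_transition_le : ∃ Q : ℝ, 0 ≤ Q ∧ ∀ s, 0 ≤ s → deriv transition s ≤ Q := by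
  obtain ⟨Q, hQ⟩ := (isCompact_Icc (a := (0 : ℝ)) (b := 1)).bddAbove_image
    continuous_deriv_transition.continuousOn
  have h0 : ∀ s ∈ Icc (0 : ℝ) 1, deriv transition s ≤ Q := fun s hs => hQ (mem_image_of_mem _ hs)
  have hQ0 : 0 ≤ Q := (deriv_transition_nonneg 0).trans (h0 0 (by norm_num))
  refine ⟨Q, hQ0, fun s hs => ?_⟩
  rcases le_or_gt s 1 with h | h
  · exact h0 s ⟨hs, h⟩
  · rwa [deriv_transition_of_ge h.le]

theorem exists_deriv_transition_pos : ∃ s, 0 < s ∧ 0 < deriv transition s := by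
  obtain ⟨s, hs, h⟩ := exists_deriv_eq_slope transition (a := 0) (b := 1) (by norm_num)
    contDiff_transition.continuous.continuousOn
    fun s _ => (hasDerivAt_transition s).differentiableAt.differentiableWithinAt
  refine ⟨s, hs.1, ?_⟩
  rw [h, transition_of_ge le_rfl, transition_of_le (by norm_num)]
  norm_num

theorem contDiff_transition_div : ContDiff ℝ ∞ fun s => transition s / s := by
  rw [contDiff_iff_contDiffAt]
  intro s
  rcases lt_or_ge s (1 / 2) with h | h
  · have : (fun s => transition s / s) =ᶠ[𝓝 s] fun _ => 0 := by
      filter_upwards [Iio_mem_nhds h] with t ht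
      rw [transition_of_le (le_of_lt ht), zero_div]
    exact contDiffAt_const.congr_of_eventuallyEq this
  · exact contDiff_transition.contDiffAt.div contDiffAt_id
      (lt_of_lt_of_le (by norm_num) h).ne'

/-- The density in `|z|²` of the truncated logarithmic kernel. -/
def kernelDensity (ε r τ : ℝ) : ℝ :=
  transition (τ / ε ^ 2) / (τ / ε ^ 2) / ε ^ 2 - transition (τ / r ^ 2) / (τ / r ^ 2) / r ^ 2

variable {ε r : ℝ}

theorem contDiff_kernelDensity (ε r : ℝ) : ContDiff ℝ ∞ (kernelDensity ε r) := by
  have h : ∀ c : ℝ, ContDiff ℝ ∞ fun τ : ℝ => transition (τ / c ^ 2) / (τ / c ^ 2) / c ^ 2 :=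
    fun c => (contDiff_transition_div.comp (contDiff_id.div_const (c ^ 2))).div_const _
  exact (h ε).sub (h r)

/-- For `ε ≤ r` the density thus lies between `0` and `1/τ` on the positive axis and vanishes near
`0` and beyond `r²`. Its integral from `s` to `r²` is a smooth substitute for `log(r²/s)`. -/
theorem mul_kernelDensity (hε : 0 < ε) (hr : 0 < r) (τ : ℝ) :
    τ * kernelDensity ε r τ = transition (τ / ε ^ 2) - transition (τ / r ^ 2) := by
  unfold kernelDensity
  rcases eq_or_ne τ 0 with rfl | h
  · simp
  · field_simp

theorem kernelDensity_nonneg (hε : 0 < ε) (hεr : ε ≤ r) {τ : ℝ} (hτ : 0 < τ) :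
    0 ≤ kernelDensity ε r τ := by
  have h := mul_kernelDensity hε (hε.trans_le hεr) τ
  have h1 : transition (τ / r ^ 2) ≤ transition (τ / ε ^ 2) := by
    refine monotone_transition ?_
    gcongr
  exact nonneg_of_mul_nonneg_right (by linarith) hτ

theorem kernelDensity_le (hε : 0 < ε) (hr : 0 < r) {τ : ℝ} (hτ : 0 < τ) :
    kernelDensity ε r τ ≤ τ⁻¹ := by
  have h := mul_kernelDensity hε hr τ
  rw [← one_div, le_div_iff₀ hτ]
  linarith [transition_le_one (τ / ε ^ 2), transition_nonneg (τ / r ^ 2)]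

theorem kernelDensity_of_ge (hε : 0 < ε) (hεr : ε ≤ r) {τ : ℝ} (hτ : r ^ 2 ≤ τ) :
    kernelDensity ε r τ = 0 := by
  have hr := hε.trans_le hεr
  have h := mul_kernelDensity hε hr τ
  have hτ0 : 0 < τ := lt_of_lt_of_le (by positivity) hτ
  have h2 : ε ^ 2 ≤ r ^ 2 := by gcongr
  rw [transition_of_ge (by rw [le_div_iff₀ (by positivity)]; linarith),
    transition_of_ge (by rw [le_div_iff₀ (by positivity)]; linarith), sub_self] at h
  exact (mul_eq_zero.1 h).resolve_left hτ0.ne'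

/-- The truncated logarithmic kernel as a function of `|z|²`. -/
def kernelProfile (ε r s : ℝ) : ℝ := ∫ τ in s..r ^ 2, kernelDensity ε r τ

theorem hasDerivAt_kernelProfile (ε r s : ℝ) :
    HasDerivAt (kernelProfile ε r) (-kernelDensity ε r s) s := by
  have hc := (contDiff_kernelDensity ε r).continuous
  exact intervalIntegral.integral_hasDerivAt_left (hc.intervalIntegrable _ _)
    hc.stronglyMeasurable.stronglyMeasurableAtFilter hc.continuousAt

theorem contDiff_kernelProfile (ε r : ℝ) : ContDiff ℝ ∞ (kernelProfile ε r) := by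
  rw [contDiff_infty_iff_deriv]
  refine ⟨fun s => (hasDerivAt_kernelProfile ε r s).differentiableAt, ?_⟩
  have : deriv (kernelProfile ε r) = fun s => -kernelDensity ε r s :=
    funext fun s => (hasDerivAt_kernelProfile ε r s).deriv
  rw [this]
  exact (contDiff_kernelDensity ε r).neg

theorem kernelProfile_of_ge (hε : 0 < ε) (hεr : ε ≤ r) {s : ℝ} (hs : r ^ 2 ≤ s) :
    kernelProfile ε r s = 0 := by
  unfold kernelProfile
  rw [intervalIntegral.integral_congr (g := fun _ => 0), intervalIntegral.integral_zero]
  intro τ hτ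
  rw [uIcc_of_ge hs] at hτ
  exact kernelDensity_of_ge hε hεr hτ.1

theorem kernelProfile_nonneg (hε : 0 < ε) (hεr : ε ≤ r) {s : ℝ} (hs : 0 < s) :
    0 ≤ kernelProfile ε r s := by
  rcases le_total (r ^ 2) s with h | h
  · rw [kernelProfile_of_ge hε hεr h]
  · exact intervalIntegral.integral_nonneg h fun τ hτ =>
      kernelDensity_nonneg hε hεr (hs.trans_le hτ.1)

theorem kernelProfile_le (hε : 0 < ε) (hr : 0 < r) {s : ℝ} (hs : 0 < s) (hsr : s ≤ r ^ 2) :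
    kernelProfile ε r s ≤ Real.log (r ^ 2 / s) := by
  rw [← integral_inv_of_pos hs (by positivity)]
  refine intervalIntegral.integral_mono_on hsr
    ((contDiff_kernelDensity ε r).continuous.intervalIntegrable _ _) ?_ fun τ hτ =>
      kernelDensity_le hε hr (hs.trans_le hτ.1)
  refine intervalIntegral.intervalIntegrable_inv (fun τ hτ => ?_) continuousOn_id
  rw [uIcc_of_le hsr] at hτ
  exact (hs.trans_le hτ.1).ne'

/-- With `w` the fourth root of `r/t`, `log(r²/t²) = 8 log w ≤ 8w`. The resulting singularity
`t^(-1/2)` is integrable against a measure of linear growth, uniformly in `ε`. -/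
theorem kernelProfile_sq_le (hε : 0 < ε) (hεr : ε ≤ r) {t : ℝ} (ht : 0 < t) (htr : t ≤ r) :
    kernelProfile ε r (t ^ 2) ^ 2 ≤ 64 * √(r / t) := by
  have hr := hε.trans_le hεr
  have hw : 0 < r / t := by positivity
  set w := √√(r / t) with hwdef
  have hw0 : 0 < w := Real.sqrt_pos.2 (Real.sqrt_pos.2 hw)
  have hw2 : w ^ 2 = √(r / t) := Real.sq_sqrt (Real.sqrt_nonneg _)
  have hw8 : r ^ 2 / t ^ 2 = w ^ 8 := by
    rw [← div_pow, show w ^ 8 = ((w ^ 2) ^ 2) ^ 2 by ring, hw2, Real.sq_sqrt hw.le]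
  have h1 := kernelProfile_le hε hr (s := t ^ 2) (by positivity) (by gcongr)
  have h0 := kernelProfile_nonneg hε hεr (s := t ^ 2) (by positivity)
  rw [hw8, Real.log_pow] at h1
  have h2 := Real.log_le_self hw0.le
  have h3 : kernelProfile ε r (t ^ 2) ≤ 8 * w := by
    push_cast at h1
    linarith
  rw [← hw2]
  nlinarith

/-! ### Mollifiers and size of the kernel -/

/-- A multiple of a smooth approximation of the identity at scale `ρ`, supported in the disc of
radius `ρ`. -/
def mollifier (ρ : ℝ) (z : Plane) : ℝ := 4 * deriv transition (‖z‖ ^ 2 / ρ ^ 2) / ρ ^ 2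

theorem continuous_mollifier (ρ : ℝ) : Continuous (mollifier ρ) := by
  have := continuous_deriv_transition.comp
    ((continuous_norm.pow 2).div_const (ρ ^ 2) : Continuous fun z : Plane => ‖z‖ ^ 2 / ρ ^ 2)
  exact (continuous_const.mul this).div_const _

theorem mollifier_nonneg (ρ : ℝ) (z : Plane) : 0 ≤ mollifier ρ z := by
  have := deriv_transition_nonneg (‖z‖ ^ 2 / ρ ^ 2)
  unfold mollifier
  positivity

theorem mollifier_of_ge {ρ : ℝ} (hρ : 0 < ρ) {z : Plane} (h : ρ ≤ ‖z‖) : mollifier ρ z = 0 := by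
  unfold mollifier
  rw [deriv_transition_of_ge, mul_zero, zero_div]
  rw [le_div_iff₀ (by positivity), one_mul]
  gcongr

theorem mollifier_eq_scale {ρ : ℝ} (hρ : 0 < ρ) (z : Plane) :
    mollifier ρ z = (ρ ^ 2)⁻¹ * mollifier 1 (ρ⁻¹ • z) := by
  unfold mollifier
  rw [norm_smul, Real.norm_eq_abs, abs_of_pos (inv_pos.2 hρ)]
  field_simp

theorem hasCompactSupport_mollifier {ρ : ℝ} (hρ : 0 < ρ) : HasCompactSupport (mollifier ρ) :=
  HasCompactSupport.intro (isCompact_closedBall 0 ρ) fun z hz => by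
    refine mollifier_of_ge hρ (le_of_lt ?_)
    simpa using hz

theorem integral_mollifier {ρ : ℝ} (hρ : 0 < ρ) : ∫ z, mollifier ρ z = ∫ z, mollifier 1 z := by
  simp_rw [mollifier_eq_scale hρ]
  rw [integral_const_mul, Measure.integral_comp_smul]
  simp [abs_of_pos hρ]
  field_simp

theorem integral_mollifier_pos : 0 < ∫ z, mollifier 1 z := by
  obtain ⟨s, hs, h⟩ := exists_deriv_transition_pos
  refine (continuous_mollifier 1).integral_pos_of_hasCompactSupport_nonneg_nonzero
    (hasCompactSupport_mollifier one_pos) (mollifier_nonneg 1)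
    (x := EuclideanSpace.single 0 √s) ?_
  unfold mollifier
  rw [PiLp.norm_single, Real.norm_eq_abs, sq_abs, Real.sq_sqrt hs.le]
  simp [h.ne']

/-- Layer cake formula: where `√(r/|y - x|)` exceeds `t`, `y` lies in the disc of radius `r min(1,
t⁻²)`. Hence its integral over the disc is at most `Dr(1 + ∫₁^∞ t⁻² dt) = 2Dr`, and `64 · 2 = 128`.
-/
theorem integral_kernel_sq_le {μ : Measure Plane} {D : ℝ} {x : Plane} (hε : 0 < ε)
    (hεr : ε ≤ r) (hD : 0 ≤ D)
    (hμ : ∀ ρ : ℝ, 0 ≤ ρ → ρ ≤ r → μ (closedBall x ρ) ≤ ENNReal.ofReal (D * ρ)) :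
    ∫⁻ y, ENNReal.ofReal (kernelProfile ε r (‖y - x‖ ^ 2) ^ 2) ∂μ ≤
      ENNReal.ofReal (128 * D * r) := by
  have hr := hε.trans_le hεr
  set f : Plane → ℝ := (closedBall x r).indicator fun y => √(r / ‖y - x‖) with hf
  have hfm : Measurable f := Measurable.indicator (by fun_prop) measurableSet_closedBall
  have hf0 : ∀ y, 0 ≤ f y := fun y => indicator_nonneg (fun y _ => Real.sqrt_nonneg _) y
  -- The centre must be discarded: division by zero makes `f` vanish there, so it does not dominate
  -- the kernel.
  have hx : μ {x} = 0 := by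
    have := hμ 0 le_rfl hr.le
    simpa using this
  have hae : ∀ᵐ y ∂μ, ENNReal.ofReal (kernelProfile ε r (‖y - x‖ ^ 2) ^ 2) ≤
      ENNReal.ofReal 64 * ENNReal.ofReal (f y) := by
    have hne : ∀ᵐ y ∂μ, y ≠ x := by
      rw [ae_iff]
      simpa using hx
    filter_upwards [hne] with y hy
    rw [← ENNReal.ofReal_mul (by norm_num)]
    refine ENNReal.ofReal_le_ofReal ?_
    have hpos : 0 < ‖y - x‖ := norm_pos_iff.2 (sub_ne_zero.2 hy)
    rcases le_or_gt ‖y - x‖ r with h | h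
    · rw [hf, indicator_of_mem (show y ∈ closedBall x r by rwa [mem_closedBall, dist_eq_norm])]
      exact kernelProfile_sq_le hε hεr hpos h
    · rw [kernelProfile_of_ge hε hεr (by gcongr), zero_pow two_ne_zero]
      have := hf0 y
      positivity
  have hlevel : ∀ t : ℝ, 0 < t → μ {y | t < f y} ≤ ENNReal.ofReal (D * r * min 1 (t ^ 2)⁻¹) := by
    intro t ht
    have hsub : {y | t < f y} ⊆ closedBall x (r * min 1 (t ^ 2)⁻¹) := by
      intro y hy
      have hy' : t < f y := hy
      by_cases hm : y ∈ closedBall x r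
      · rw [hf, indicator_of_mem hm, Real.lt_sqrt ht.le] at hy'
        rw [mem_closedBall, dist_eq_norm] at hm ⊢
        rw [mul_min_of_nonneg _ _ hr.le, mul_one, le_min_iff]
        refine ⟨hm, ?_⟩
        have hpos : 0 < ‖y - x‖ := by
          refine lt_of_le_of_ne (norm_nonneg _) fun h0 => ?_
          rw [← h0, div_zero] at hy'
          exact absurd hy' (not_lt.2 (sq_nonneg t))
        rw [lt_div_iff₀ hpos] at hy'
        rw [← div_eq_mul_inv, le_div_iff₀ (by positivity)]
        linarith
      · rw [hf, indicator_of_notMem hm] at hy'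
        exact absurd hy' (not_lt.2 ht.le)
    refine (measure_mono hsub).trans ((hμ _ (by positivity) ?_).trans_eq ?_)
    · exact mul_le_of_le_one_right hr.le (min_le_left _ _)
    · rw [mul_assoc]
  have hint : ∫⁻ y, ENNReal.ofReal (f y) ∂μ ≤ ENNReal.ofReal (2 * D * r) := by
    rw [lintegral_eq_lintegral_meas_lt μ (Eventually.of_forall hf0) hfm.aemeasurable,
      ← Ioc_union_Ioi_eq_Ioi zero_le_one,
      lintegral_union measurableSet_Ioi (Ioc_disjoint_Ioi le_rfl)]
    have h1 : ∫⁻ t in Ioc (0 : ℝ) 1, μ {y | t < f y} ≤ ENNReal.ofReal (D * r) := by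
      calc ∫⁻ t in Ioc (0 : ℝ) 1, μ {y | t < f y} ≤
            ∫⁻ _ in Ioc (0 : ℝ) 1, ENNReal.ofReal (D * r) := by
            refine setLIntegral_mono' measurableSet_Ioc fun t ht => (hlevel t ht.1).trans ?_
            refine ENNReal.ofReal_le_ofReal ?_
            exact mul_le_of_le_one_right (by positivity) (min_le_left _ _)
        _ = _ := by simp
    have h2 : ∫⁻ t in Ioi (1 : ℝ), μ {y | t < f y} ≤ ENNReal.ofReal (D * r) := by
      calc ∫⁻ t in Ioi (1 : ℝ), μ {y | t < f y} ≤
            ∫⁻ t in Ioi (1 : ℝ), ENNReal.ofReal (D * r * t ^ (-2 : ℝ)) := by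
            refine setLIntegral_mono' measurableSet_Ioi fun t ht => ?_
            have ht0 : (0 : ℝ) < t := zero_lt_one.trans ht
            refine (hlevel t ht0).trans (ENNReal.ofReal_le_ofReal ?_)
            rw [Real.rpow_neg ht0.le, Real.rpow_two]
            exact mul_le_mul_of_nonneg_left (min_le_right _ _) (by positivity)
        _ = ENNReal.ofReal (D * r) := by
            rw [← ofReal_integral_eq_lintegral_ofReal
              ((integrableOn_Ioi_rpow_of_lt (by norm_num) one_pos).const_mul _)]
            · rw [integral_const_mul, integral_Ioi_rpow_of_lt (by norm_num) one_pos]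
              norm_num
            · refine (ae_restrict_iff' measurableSet_Ioi).2 (Eventually.of_forall fun t ht => ?_)
              have ht0 : (0 : ℝ) < t := zero_lt_one.trans ht
              simp only [Pi.zero_apply]
              positivity
    refine (add_le_add h1 h2).trans_eq ?_
    rw [← ENNReal.ofReal_add (by positivity) (by positivity)]
    congr 1
    ring
  calc ∫⁻ y, ENNReal.ofReal (kernelProfile ε r (‖y - x‖ ^ 2) ^ 2) ∂μ
      ≤ ∫⁻ y, ENNReal.ofReal 64 * ENNReal.ofReal (f y) ∂μ := lintegral_mono_ae hae
    _ = ENNReal.ofReal 64 * ∫⁻ y, ENNReal.ofReal (f y) ∂μ :=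
        lintegral_const_mul' _ _ ENNReal.ofReal_ne_top
    _ ≤ ENNReal.ofReal 64 * ENNReal.ofReal (2 * D * r) := mul_le_mul_right hint _
    _ = _ := by
        rw [← ENNReal.ofReal_mul (by norm_num)]
        congr 1
        ring

/-! ### Laplacian of the kernel -/

theorem partialDeriv_ofReal {G : Plane → ℝ} {L : Plane →L[ℝ] ℝ} {y : Plane} (i : Fin 2)
    (h : HasFDerivAt G L y) :
    partialDeriv i (fun y => (G y : ℂ)) y = (L (EuclideanSpace.single i (1 : ℝ)) : ℂ) := by
  unfold partialDeriv
  have := (Complex.ofRealCLM.hasFDerivAt.comp y h).fderiv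
  simp only [Function.comp_def, Complex.ofRealCLM_apply] at this
  rw [this]
  simp

theorem hasFDerivAt_radial {f : ℝ → ℝ} {f' : ℝ} (x y : Plane)
    (h : HasDerivAt f f' (‖y - x‖ ^ 2)) :
    HasFDerivAt (fun y : Plane => f (‖y - x‖ ^ 2)) (f' • (2 • innerSL ℝ (y - x))) y := by
  have h1 : HasFDerivAt (fun y : Plane => ‖y - x‖ ^ 2) (2 • innerSL ℝ (y - x)) y := by
    have := (hasStrictFDerivAt_norm_sq (y - x)).hasFDerivAt.comp y (hasFDerivAt_sub_const x)
    rw [ContinuousLinearMap.comp_id] at this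
    exact this
  exact h.comp_hasFDerivAt y h1

theorem innerSL_single (v : Plane) (i : Fin 2) :
    innerSL ℝ v (EuclideanSpace.single i (1 : ℝ)) = v i := by
  simp [EuclideanSpace.inner_single_right]

/-- The truncated logarithmic kernel centred at `x`. -/
def logKernel (ε r : ℝ) (x y : Plane) : ℂ := (kernelProfile ε r (‖y - x‖ ^ 2) : ℝ)

theorem isTestFunction_logKernel (hε : 0 < ε) (hεr : ε ≤ r) (x : Plane) :
    IsTestFunction (logKernel ε r x) := by
  constructor
  · have h1 : ContDiff ℝ ∞ fun y : Plane => ‖y - x‖ ^ 2 :=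
      (contDiff_id.sub contDiff_const).norm_sq ℝ
    exact Complex.ofRealCLM.contDiff.comp ((contDiff_kernelProfile ε r).comp h1)
  · refine HasCompactSupport.intro (isCompact_closedBall x r) fun y hy => ?_
    rw [mem_closedBall, dist_eq_norm, not_le] at hy
    unfold logKernel
    rw [kernelProfile_of_ge hε hεr, Complex.ofReal_zero]
    have := hε.trans_le hεr
    gcongr

theorem partialDeriv_logKernel (i : Fin 2) (x : Plane) :
    partialDeriv i (logKernel ε r x) =
      fun y => ((-2 * (kernelDensity ε r (‖y - x‖ ^ 2) * (y i - x i)) : ℝ) : ℂ) := by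
  ext y
  have h := partialDeriv_ofReal i (hasFDerivAt_radial x y (hasDerivAt_kernelProfile ε r _))
  refine h.trans ?_
  congr 1
  simp only [smul_apply, innerSL_single, smul_eq_mul, nsmul_eq_mul,
    PiLp.sub_apply]
  push_cast
  ring

theorem partialDeriv_partialDeriv_logKernel (i : Fin 2) (x y : Plane) :
    partialDeriv i (partialDeriv i (logKernel ε r x)) y =
      ((-4 * deriv (kernelDensity ε r) (‖y - x‖ ^ 2) * (y i - x i) ^ 2 -
        2 * kernelDensity ε r (‖y - x‖ ^ 2) : ℝ) : ℂ) := by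
  rw [partialDeriv_logKernel]
  have h1 := hasFDerivAt_radial x y
    ((contDiff_kernelDensity ε r).differentiable (by norm_num) _).hasDerivAt
  have h2 : HasFDerivAt (fun y : Plane => y i - x i) (EuclideanSpace.proj i : Plane →L[ℝ] ℝ) y :=
    ((EuclideanSpace.proj i : Plane →L[ℝ] ℝ).hasFDerivAt).sub_const (x i)
  have h := partialDeriv_ofReal i ((h1.mul h2).const_mul (-2))
  refine h.trans ?_
  congr 1
  simp only [smul_apply, add_apply, innerSL_single,
    smul_eq_mul, nsmul_eq_mul, PiLp.sub_apply]
  simp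
  ring

/-- Minus the Laplacian of the kernel is a difference of two approximations of the identity. -/
theorem laplacian_logKernel (hε : 0 < ε) (hr : 0 < r) (x y : Plane) :
    ∑ i, partialDeriv i (partialDeriv i (logKernel ε r x)) y =
      ((mollifier r (y - x) - mollifier ε (y - x) : ℝ) : ℂ) := by
  simp_rw [partialDeriv_partialDeriv_logKernel]
  rw [← Complex.ofReal_sum]
  congr 1
  set s := ‖y - x‖ ^ 2 with hs
  have hsum : s = (y 0 - x 0) ^ 2 + (y 1 - x 1) ^ 2 := by
    rw [hs, EuclideanSpace.real_norm_sq_eq, Fin.sum_univ_two]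
    rfl
  have hk := ((contDiff_kernelDensity ε r).differentiable (by norm_num) s).hasDerivAt
  -- In the plane the Laplacian of `F(|z|²)` is `4(sF')'` at `s = |z|²`. Here `F' = -kernelDensity`,
  -- and `τ * kernelDensity ε r τ` is a difference of transitions, whose derivative gives the
  -- mollifiers.
  have h1 : HasDerivAt (fun τ => τ * kernelDensity ε r τ)
      (1 * kernelDensity ε r s + s * deriv (kernelDensity ε r) s) s := (hasDerivAt_id s).mul hk
  have h2 : HasDerivAt (fun τ => transition (τ / ε ^ 2) - transition (τ / r ^ 2))
      (deriv transition (s / ε ^ 2) * (1 / ε ^ 2) - deriv transition (s / r ^ 2) * (1 / r ^ 2)) s :=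
    ((hasDerivAt_transition _).comp s ((hasDerivAt_id s).div_const _)).sub
      ((hasDerivAt_transition _).comp s ((hasDerivAt_id s).div_const _))
  rw [show (fun τ => τ * kernelDensity ε r τ) =
    fun τ => transition (τ / ε ^ 2) - transition (τ / r ^ 2) from
      funext (mul_kernelDensity hε hr)] at h1
  have h3 := h1.unique h2
  unfold mollifier
  rw [Fin.sum_univ_two, ← hs]
  have e1 : -4 * deriv (kernelDensity ε r) s * (y 0 - x 0) ^ 2 - 2 * kernelDensity ε r s +
      (-4 * deriv (kernelDensity ε r) s * (y 1 - x 1) ^ 2 - 2 * kernelDensity ε r s) =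
      -4 * (1 * kernelDensity ε r s + s * deriv (kernelDensity ε r) s) := by
    rw [hsum]
    ring
  rw [e1, h3]
  ring

/-! ### Representation of averages and Lebesgue differentiation -/

theorem IsTestFunction.memLp {φ : Plane → ℂ} (h : IsTestFunction φ) (p : ℝ≥0∞) (μ : Measure Plane)
    [IsFiniteMeasureOnCompacts μ] : MemLp φ p μ :=
  h.continuous.memLp_of_hasCompactSupport h.2

theorem IsTestFunction.hasSobolevGradient {φ : Plane → ℂ} (h : IsTestFunction φ) :
    HasSobolevGradient φ fun i => LeakyCurve.partialDeriv i φ where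
  memLp := h.memLp 2 volume
  memLp_grad i := (h.partialDeriv i).memLp 2 volume
  weak i χ hχ := by
    have hφ := h.memLp 2 volume
    have hχ' := hχ.memLp 2 volume
    exact integral_mul_fderiv_eq_neg_fderiv_mul_of_integrable
      (((h.partialDeriv i).memLp 2 volume).integrable_mul hχ')
      (hφ.integrable_mul ((hχ.partialDeriv i).memLp 2 volume)) (hφ.integrable_mul hχ')
      (fun y _ => h.1.differentiable (by norm_num) y)
      (fun y _ => hχ.1.differentiable (by norm_num) y)

theorem IsTestFunction.isTrace {φ : Plane → ℂ} (h : IsTestFunction φ) (σ : Measure Plane)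
    [IsFiniteMeasureOnCompacts σ] : IsTrace σ φ (fun i => LeakyCurve.partialDeriv i φ) φ where
  memLp := h.memLp 2 σ
  approx := ⟨fun _ => φ, fun _ => h, by simp, by simp, by simp⟩

theorem memLp_mollifier {ρ : ℝ} (hρ : 0 < ρ) (x : Plane) :
    MemLp (fun y => (mollifier ρ (y - x) : ℂ)) 2 := by
  refine Continuous.memLp_of_hasCompactSupport ?_ ?_
  · exact Complex.continuous_ofReal.comp
      ((continuous_mollifier ρ).comp (continuous_id.sub continuous_const))
  · refine HasCompactSupport.intro (isCompact_closedBall x ρ) fun y hy => ?_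
    rw [mem_closedBall, dist_eq_norm, not_le] at hy
    rw [mollifier_of_ge hρ hy.le, Complex.ofReal_zero]

/-- The eigenvalue equation is tested with the kernel, and the weak gradient moves the remaining
derivative onto it, producing the two mollifiers. A localized Green representation formula. -/
theorem integral_mollifier_eq {Γ : FiniteCurve} {α κ : ℝ} {ψ tψ : Plane → ℂ}
    {gψ : Fin 2 → Plane → ℂ} (hu : HasSobolevGradient ψ gψ)
    (hform : ∀ (φ : Plane → ℂ) (gφ : Fin 2 → Plane → ℂ) (tφ : Plane → ℂ),
      HasSobolevGradient φ gφ → IsTrace Γ.arcMeasure φ gφ tφ →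
      form Γ.arcMeasure α gψ tψ gφ tφ = ∫ x, ((-κ ^ 2 : ℝ) : ℂ) * ψ x * (starRingEnd ℂ) (φ x))
    (hε : 0 < ε) (hεr : ε ≤ r) (x : Plane) :
    ∫ y, (mollifier ε (y - x) : ℂ) * ψ y = (∫ y, (mollifier r (y - x) : ℂ) * ψ y) +
      α * (∫ y, tψ y * logKernel ε r x y ∂Γ.arcMeasure) - κ ^ 2 * ∫ y, ψ y * logKernel ε r x y := by
  have hr := hε.trans_le hεr
  have hφ := isTestFunction_logKernel hε hεr x
  have hd := fun i => hφ.partialDeriv i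
  have h1 := hform _ _ _ hφ.hasSobolevGradient (hφ.isTrace Γ.arcMeasure)
  have hconj : ∀ y, (starRingEnd ℂ) (logKernel ε r x y) = logKernel ε r x y := fun y =>
    Complex.conj_ofReal _
  have hconj' : ∀ i y, (starRingEnd ℂ) (partialDeriv i (logKernel ε r x) y) =
      partialDeriv i (logKernel ε r x) y := fun i y => by
    rw [partialDeriv_logKernel]
    exact Complex.conj_ofReal _
  unfold form at h1
  simp_rw [hconj, hconj', mul_assoc, integral_const_mul] at h1
  have hint : ∀ i, Integrable fun y => gψ i y * partialDeriv i (logKernel ε r x) y := fun i =>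
    (hu.memLp_grad i).integrable_mul ((hd i).memLp 2 volume)
  have hint' : ∀ i, Integrable fun y =>
      ψ y * partialDeriv i (partialDeriv i (logKernel ε r x)) y := fun i =>
    hu.memLp.integrable_mul (((hd i).partialDeriv i).memLp 2 volume)
  rw [integral_finsetSum _ fun i _ => hint i] at h1
  have h2 : ∑ i, ∫ y, gψ i y * partialDeriv i (logKernel ε r x) y =
      -∫ y, ψ y * ((mollifier r (y - x) - mollifier ε (y - x) : ℝ) : ℂ) := by
    have h3 : ∀ i, ∫ y, gψ i y * partialDeriv i (logKernel ε r x) y =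
        -∫ y, ψ y * partialDeriv i (partialDeriv i (logKernel ε r x)) y := fun i => by
      rw [hu.weak i _ (hd i), neg_neg]
    simp_rw [h3, Finset.sum_neg_distrib]
    rw [← integral_finsetSum _ fun i _ => hint' i]
    simp_rw [← Finset.mul_sum, laplacian_logKernel hε hr]
  have hm : ∀ ρ : ℝ, 0 < ρ → Integrable fun y => ψ y * (mollifier ρ (y - x) : ℂ) := by
    intro ρ hρ
    exact hu.memLp.integrable_mul (memLp_mollifier hρ x)
  have h4 : ∫ y, ψ y * ((mollifier r (y - x) - mollifier ε (y - x) : ℝ) : ℂ) =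
      (∫ y, ψ y * (mollifier r (y - x) : ℂ)) - ∫ y, ψ y * (mollifier ε (y - x) : ℂ) := by
    rw [← integral_sub (hm r hr) (hm ε hε)]
    congr 1
    ext y
    push_cast
    ring
  rw [h2, h4] at h1
  simp_rw [mul_comm _ (ψ _)]
  push_cast at h1
  linear_combination h1

/-- Lebesgue differentiation with the mollifiers. -/
theorem ae_tendsto_integral_mollifier {ψ : Plane → ℂ} (hψ : LocallyIntegrable ψ) :
    ∀ᵐ x : Plane, Tendsto (fun ε : ℝ => ∫ y, (mollifier ε (y - x) : ℂ) * ψ y) (𝓝[>] 0)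
      (𝓝 ((∫ z, mollifier 1 z : ℝ) * ψ x)) := by
  obtain ⟨Q, hQ0, hQ⟩ := exists_deriv_transition_le
  set I := ∫ z, mollifier 1 z with hI
  have hIpos : 0 < I := integral_mollifier_pos
  filter_upwards [(Besicovitch.vitaliFamily volume).ae_tendsto_average_norm_sub hψ] with x hx
  have h1 := hx.comp (Besicovitch.tendsto_filterAt volume x)
  have h2 := tendsto_integral_smul_of_tendsto_average_norm_sub
    (g := fun ε y => I⁻¹ * mollifier ε (y - x)) (4 * Q * Real.pi / I) h1
    (Eventually.of_forall fun ε => hψ.integrableOn_isCompact (isCompact_closedBall _ _)) ?_ ?_ ?_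
  · have h3 := h2.const_mul (I : ℂ)
    refine h3.congr fun ε => ?_
    rw [← integral_const_mul]
    congr 1
    ext y
    rw [Complex.real_smul]
    have : (I : ℂ) ≠ 0 := Complex.ofReal_ne_zero.2 hIpos.ne'
    push_cast
    field_simp
  · refine tendsto_const_nhds.congr' ?_
    filter_upwards [self_mem_nhdsWithin] with ε hε
    rw [integral_const_mul, integral_sub_right_eq_self (mollifier ε) x, integral_mollifier hε,
      ← hI, inv_mul_cancel₀ hIpos.ne']
  · filter_upwards [self_mem_nhdsWithin] with ε hε y hy
    by_contra hmem
    rw [mem_closedBall, dist_eq_norm, not_le] at hmem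
    exact hy (by simp only; rw [mollifier_of_ge hε hmem.le, mul_zero])
  · filter_upwards [self_mem_nhdsWithin] with ε hε y
    have hε' : 0 < ε := hε
    have hreal : volume.real (closedBall x ε) = ε ^ 2 * Real.pi := by
      rw [Measure.real, volume_closedBall_eq x hε'.le, ENNReal.toReal_ofReal (by positivity)]
    rw [hreal, abs_of_nonneg (mul_nonneg (inv_pos.2 hIpos).le (mollifier_nonneg _ _))]
    unfold mollifier
    have h3 := hQ (‖y - x‖ ^ 2 / ε ^ 2) (by positivity)
    calc I⁻¹ * (4 * deriv transition (‖y - x‖ ^ 2 / ε ^ 2) / ε ^ 2) ≤ I⁻¹ * (4 * Q / ε ^ 2) := by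
          gcongr
      _ = 4 * Q * Real.pi / I / (ε ^ 2 * Real.pi) := by
          field_simp

/-! ### Local boundedness of eigenfunctions -/

theorem norm_integral_mul_le {X : Type*} [MeasurableSpace X] {μ : Measure X} {f g : X → ℂ}
    (hf : MemLp f 2 μ) (hg : MemLp g 2 μ) :
    ‖∫ x, f x * g x ∂μ‖ ≤ √(∫ x, ‖f x‖ ^ 2 ∂μ) * √(∫ x, ‖g x‖ ^ 2 ∂μ) := by
  refine (norm_integral_le_integral_norm _).trans ?_
  simp_rw [norm_mul]
  have h := integral_mul_norm_le_Lp_mul_Lq (p := 2) (q := 2) (μ := μ) (f := f) (g := g)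
    Real.HolderConjugate.two_two (by simpa using hf) (by simpa using hg)
  simpa [Real.sqrt_eq_rpow] using h

theorem integral_norm_logKernel_sq_le {μ : Measure Plane} [IsFiniteMeasureOnCompacts μ] {D : ℝ}
    {x : Plane} (hε : 0 < ε) (hεr : ε ≤ r) (hD : 0 ≤ D)
    (hμ : ∀ ρ : ℝ, 0 ≤ ρ → ρ ≤ r → μ (closedBall x ρ) ≤ ENNReal.ofReal (D * ρ)) :
    ∫ y, ‖logKernel ε r x y‖ ^ 2 ∂μ ≤ 128 * D * r := by
  have hr := hε.trans_le hεr
  have h := integral_kernel_sq_le hε hεr hD hμ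
  rw [← ENNReal.ofReal_le_ofReal_iff (by positivity),
    ofReal_integral_norm_sq ((isTestFunction_logKernel hε hεr x).memLp 2 μ), eLpNorm_two_sq]
  refine le_trans (le_of_eq (lintegral_congr fun y => ?_)) h
  unfold logKernel
  rw [← ofReal_norm, ← ENNReal.ofReal_pow (norm_nonneg _), Complex.norm_real, Real.norm_eq_abs,
    sq_abs]

/-- Up to scale `r`, planar measure also has linear growth, with constant `πr`, so one kernel
estimate serves both measures. -/
theorem volume_closedBall_le_mul (x : Plane) {ρ : ℝ} (hρ : 0 ≤ ρ) (hρr : ρ ≤ r) :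
    volume (closedBall x ρ) ≤ ENNReal.ofReal (Real.pi * r * ρ) := by
  rw [volume_closedBall_eq x hρ]
  refine ENNReal.ofReal_le_ofReal ?_
  have := mul_le_mul_of_nonneg_right hρr hρ
  nlinarith [Real.pi_pos]

theorem integral_norm_mollifier_sq_le {Q : ℝ}
    (hQ : ∀ s, 0 ≤ s → deriv transition s ≤ Q) (hr : 0 < r) (x : Plane) :
    ∫ y, ‖(mollifier r (y - x) : ℂ)‖ ^ 2 ≤ (8 * Q / r) ^ 2 := by
  have hb : ∀ y : Plane, ‖(mollifier r (y - x) : ℂ)‖ ^ 2 ≤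
      (closedBall x r).indicator (fun _ => (4 * Q / r ^ 2) ^ 2) y := by
    intro y
    rw [Complex.norm_real, Real.norm_eq_abs, sq_abs]
    by_cases hy : y ∈ closedBall x r
    · rw [indicator_of_mem hy]
      have h0 := mollifier_nonneg r (y - x)
      have h1 : mollifier r (y - x) ≤ 4 * Q / r ^ 2 := by
        unfold mollifier
        have h3 := hQ (‖y - x‖ ^ 2 / r ^ 2) (by positivity)
        gcongr
      gcongr
    · rw [indicator_of_notMem hy]
      rw [mem_closedBall, dist_eq_norm, not_le] at hy
      rw [mollifier_of_ge hr hy.le, zero_pow two_ne_zero]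
  calc ∫ y, ‖(mollifier r (y - x) : ℂ)‖ ^ 2
      ≤ ∫ y, (closedBall x r).indicator (fun _ => (4 * Q / r ^ 2) ^ 2) y := by
        refine integral_mono (memLp_mollifier hr x).norm.integrable_sq ?_ hb
        exact (integrable_indicator_iff measurableSet_closedBall).2
          (integrableOn_const (measure_closedBall_lt_top).ne)
    _ = (r ^ 2 * Real.pi) * (4 * Q / r ^ 2) ^ 2 := by
        rw [integral_indicator_const _ measurableSet_closedBall, Measure.real,
          volume_closedBall_eq x hr.le, ENNReal.toReal_ofReal (by positivity), smul_eq_mul]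
    _ ≤ (r ^ 2 * 4) * (4 * Q / r ^ 2) ^ 2 := by
        gcongr
        exact Real.pi_le_four
    _ = _ := by
        field_simp
        ring

/-- The local boundedness estimate for eigenfunctions, with the mollifiers in place of the
function itself. -/
theorem norm_integral_mollifier_le {Γ : FiniteCurve} {α κ D Q : ℝ} {ψ tψ : Plane → ℂ}
    {gψ : Fin 2 → Plane → ℂ} (hQ0 : 0 ≤ Q) (hQ : ∀ s, 0 ≤ s → deriv transition s ≤ Q)
    (hα : 0 < α) (hD : 0 < D)
    (hσ : ∀ (x : Plane) (ρ : ℝ), 0 ≤ ρ → Γ.arcMeasure (closedBall x ρ) ≤ ENNReal.ofReal (D * ρ))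
    (hu : HasSobolevGradient ψ gψ) (ht : IsTrace Γ.arcMeasure ψ gψ tψ)
    (hform : ∀ (φ : Plane → ℂ) (gφ : Fin 2 → Plane → ℂ) (tφ : Plane → ℂ),
      HasSobolevGradient φ gφ → IsTrace Γ.arcMeasure φ gφ tφ →
      form Γ.arcMeasure α gψ tψ gφ tφ = ∫ x, ((-κ ^ 2 : ℝ) : ℂ) * ψ x * (starRingEnd ℂ) (φ x))
    (hrdef : r = 1 / (40 * D * α + 1)) (hε : 0 < ε) (hεr : ε ≤ r) (x : Plane) :
    ‖∫ y, (mollifier ε (y - x) : ℂ) * ψ y‖ ≤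
      (8 * Q + 24) * ((40 * D * α + 1) * (κ ^ 2 + 1)) * √(∫ y, ‖ψ y‖ ^ 2) := by
  have hr : 0 < r := hε.trans_le hεr
  have hrinv : 40 * D * α + 1 = 1 / r := by rw [hrdef, one_div_one_div]
  have hr1 : r ≤ 1 := by
    rw [hrdef]
    exact div_le_one_of_le₀ (by have : 0 ≤ 40 * D * α := by positivity
                                linarith) (by positivity)
  -- The scale `r` is chosen for this: it meets the absorption condition `32Dαr ≤ 1`, and `1/r` is
  -- the factor `40Dα + 1` of the bound.
  have hDα : D * α * r ≤ 1 / 40 := by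
    rw [hrdef]
    field_simp
    linarith
  set S := √(∫ y, ‖ψ y‖ ^ 2) with hS
  have hS0 : 0 ≤ S := Real.sqrt_nonneg _
  have hN := (isTestFunction_logKernel hε hεr x)
  have b1 : ‖∫ y, (mollifier r (y - x) : ℂ) * ψ y‖ ≤ 8 * Q / r * S := by
    refine (norm_integral_mul_le (memLp_mollifier hr x) hu.memLp).trans ?_
    refine mul_le_mul_of_nonneg_right ?_ hS0
    exact Real.sqrt_le_iff.2 ⟨by positivity, integral_norm_mollifier_sq_le hQ hr x⟩
  have b2 : ‖∫ y, ψ y * logKernel ε r x y‖ ≤ S * (24 * r) := by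
    refine (norm_integral_mul_le hu.memLp (hN.memLp 2 volume)).trans ?_
    refine mul_le_mul_of_nonneg_left ?_ hS0
    refine Real.sqrt_le_iff.2 ⟨by positivity, ?_⟩
    refine (integral_norm_logKernel_sq_le hε hεr (D := Real.pi * r) (by positivity)
      fun ρ h0 h1 => volume_closedBall_le_mul x h0 h1).trans ?_
    have := Real.pi_le_four
    nlinarith [sq_nonneg r]
  have b3 : ‖∫ y, tψ y * logKernel ε r x y ∂Γ.arcMeasure‖ ≤ S * (24 * D) := by
    refine (norm_integral_mul_le ht.memLp (hN.memLp 2 Γ.arcMeasure)).trans ?_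
    have t1 := integral_norm_sq_trace_le ht hu hD.le hσ hr (by linarith) (hform ψ gψ tψ hu ht)
    have t2 := integral_norm_logKernel_sq_le (μ := Γ.arcMeasure) (x := x) hε hεr hD.le
      fun ρ h0 _ => hσ x ρ h0
    rw [← Real.sqrt_mul (integral_nonneg fun y => by positivity)]
    refine Real.sqrt_le_iff.2 ⟨by positivity, ?_⟩
    -- The powers of `r` cancel, leaving `512 D² ≤ (24D)²`.
    calc (∫ y, ‖tψ y‖ ^ 2 ∂Γ.arcMeasure) * (∫ y, ‖logKernel ε r x y‖ ^ 2 ∂Γ.arcMeasure)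
        ≤ (4 * D / r * ∫ y, ‖ψ y‖ ^ 2) * (128 * D * r) := by
          refine mul_le_mul t1 t2 (integral_nonneg fun y => by positivity) ?_
          exact mul_nonneg (by positivity) (integral_nonneg fun y => by positivity)
      _ = S ^ 2 * (512 * D ^ 2) := by
          rw [hS, Real.sq_sqrt (integral_nonneg fun y => by positivity)]
          field_simp
          ring
      _ ≤ (S * (24 * D)) ^ 2 := by
          rw [mul_pow, mul_pow]
          gcongr
          norm_num
  rw [integral_mollifier_eq hu hform hε hεr x]
  refine (norm_sub_le _ _).trans ((add_le_add_left (norm_add_le _ _) _).trans ?_)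
  rw [norm_mul, norm_mul, norm_pow, Complex.norm_real, Complex.norm_real, Real.norm_eq_abs,
    Real.norm_eq_abs, abs_of_pos hα, sq_abs, hrinv]
  have c1 := mul_le_mul_of_nonneg_left b2 (sq_nonneg κ)
  have c2 := mul_le_mul_of_nonneg_left b3 hα.le
  have hinv : 1 ≤ 1 / r := by rw [le_div_iff₀ hr]; linarith
  have c3 : α * (S * (24 * D)) ≤ 24 * (1 / r) * S := by
    have : α * D ≤ 1 / r := by
      rw [le_div_iff₀ hr]
      linarith
    nlinarith
  have c4 : κ ^ 2 * (S * (24 * r)) ≤ 24 * (1 / r) * κ ^ 2 * S := by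
    have : r ≤ 1 / r := hr1.trans hinv
    have := mul_le_mul_of_nonneg_left this (mul_nonneg (sq_nonneg κ) hS0)
    linarith
  have c5 : 0 ≤ 8 * Q * (1 / r) * κ ^ 2 * S := by positivity
  have c6 : 8 * Q / r * S = 8 * Q * (1 / r) * S := by ring
  linarith

theorem mul_exp_neg_le {η x : ℝ} (hη : 0 < η) : x * Real.exp (-η * x) ≤ 1 / η := by
  have h := Real.add_one_le_exp (η * x)
  rw [neg_mul, Real.exp_neg, ← div_eq_mul_inv, div_le_div_iff₀ (Real.exp_pos _) hη]
  linarith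

theorem eLpNorm_two_eq_ofReal {X E : Type*} [MeasurableSpace X] [NormedAddCommGroup E]
    {μ : Measure X} {f : X → E} (hf : MemLp f 2 μ) :
    eLpNorm f 2 μ = ENNReal.ofReal √(∫ x, ‖f x‖ ^ 2 ∂μ) := by
  have h := ofReal_integral_norm_sq hf
  rw [← Real.sq_sqrt (integral_nonneg fun x => by positivity : 0 ≤ ∫ x, ‖f x‖ ^ 2 ∂μ),
    ENNReal.ofReal_pow (Real.sqrt_nonneg _)] at h
  exact ((ENNReal.pow_right_strictMono two_ne_zero).injective h).symm

/-- Eigenfunctions are bounded. -/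
theorem eLpNorm_top_le {Γ : FiniteCurve} {α κ D Q : ℝ} {ψ : Plane → ℂ} (hQ0 : 0 ≤ Q)
    (hQ : ∀ s, 0 ≤ s → deriv transition s ≤ Q) (hα : 0 < α) (hD : 0 < D)
    (hσ : ∀ (x : Plane) (ρ : ℝ), 0 ≤ ρ → Γ.arcMeasure (closedBall x ρ) ≤ ENNReal.ofReal (D * ρ))
    (hψ : IsEigenfunction Γ α (-κ ^ 2) ψ) :
    eLpNorm ψ ⊤ volume ≤ ENNReal.ofReal ((8 * Q + 24) / (∫ z, mollifier 1 z) *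
      ((40 * D * α + 1) * (κ ^ 2 + 1))) * eLpNorm ψ 2 volume := by
  obtain ⟨⟨-, gψ, tψ, hu, ht, hform⟩, -⟩ := hψ
  set I := ∫ z, mollifier 1 z with hI
  have hIpos : 0 < I := integral_mollifier_pos
  rw [eLpNorm_two_eq_ofReal hu.memLp, ← ENNReal.ofReal_mul (by positivity), eLpNorm_exponent_top]
  refine eLpNormEssSup_le_of_ae_bound ?_
  filter_upwards [ae_tendsto_integral_mollifier (hu.memLp.locallyIntegrable one_le_two)] with x hx
  have hr : 0 < 1 / (40 * D * α + 1) := by positivity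
  have h1 := le_of_tendsto hx.norm (by
    filter_upwards [Ioc_mem_nhdsGT hr] with ε hε
    exact norm_integral_mollifier_le hQ0 hQ hα hD hσ hu ht hform rfl hε.1 hε.2 x)
  rw [norm_mul, Complex.norm_real, Real.norm_eq_abs, abs_of_pos hIpos, mul_comm,
    ← le_div_iff₀ hIpos] at h1
  refine h1.trans_eq ?_
  ring

end LeakyCurve

/-! ### Choice of constants -/

theorem lemma5p5 :
    ∃ (η₀ : ℝ) (c₃ : ℝ → ℝ → ℝ) (c₄ : ℝ → ℝ), 0 < η₀ ∧ (∀ M : ℝ, 0 < M → 0 < c₄ M) ∧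
      (∀ Γ : LeakyCurve.FiniteCurve,
        Γ.LogDistanceBound (c₃ Γ.injConst Γ.maxCurvature) (c₄ Γ.injConst)) ∧
      ∀ (Γ : LeakyCurve.FiniteCurve) (α κ : ℝ) (ψ : LeakyCurve.Plane → ℂ), 0 < α → 0 < κ →
        LeakyCurve.IsEigenfunction Γ α (-κ ^ 2) ψ →
        ENNReal.ofReal
            (κ * Γ.radius /
              ((LeakyCurve.c₅ (c₃ Γ.injConst Γ.maxCurvature) (c₄ Γ.injConst) Γ.length * α + 1) ^ 2
                * (κ ^ 2 + 1)) * Real.exp (-η₀ * κ * Γ.radius))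
            * MeasureTheory.eLpNorm ψ ⊤ MeasureTheory.volume
          ≤ MeasureTheory.eLpNorm ψ 2 MeasureTheory.volume := by
  obtain ⟨Q, hQ0, hQ⟩ := LeakyCurve.exists_deriv_transition_le
  set C := (8 * Q + 24) / ∫ z, LeakyCurve.mollifier 1 z with hC
  have hCpos : 0 < C := div_pos (by positivity) LeakyCurve.integral_mollifier_pos
  -- The decay rate `η₀` is the constant `C` of the local bound, so that `κR exp(-CκR) ≤ 1/C`
  -- compensates the factor `C` exactly.
  refine ⟨C, fun M _ => 160 / M, fun M => 80 / M, hCpos, fun M hM => by positivity,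
    fun Γ => Γ.logDistanceBound, fun Γ α κ ψ hα hκ hψ => ?_⟩
  have hM := Γ.injConst_pos
  have hD : 0 < 4 / Γ.injConst := by positivity
  have h := LeakyCurve.eLpNorm_top_le hQ0 hQ hα hD
    (fun x ρ hρ => Γ.arcMeasure_closedBall_le x hρ) hψ
  rw [← hC] at h
  set c := LeakyCurve.c₅ (160 / Γ.injConst) (80 / Γ.injConst) Γ.length with hc
  have hc1 : 40 * (4 / Γ.injConst) ≤ c := by
    refine le_trans (le_of_eq ?_) (le_max_left _ _)
    ring
  -- The first power of `cα + 1` already dominates; squaring a number at least 1 only helps.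
  have hA : 40 * (4 / Γ.injConst) * α + 1 ≤ (c * α + 1) ^ 2 := by
    have h1 : 40 * (4 / Γ.injConst) * α ≤ c * α := mul_le_mul_of_nonneg_right hc1 hα.le
    have h2 : 0 ≤ 40 * (4 / Γ.injConst) * α := by positivity
    nlinarith
  set A := 40 * (4 / Γ.injConst) * α + 1 with hAdef
  have hApos : 0 < A := by positivity
  have hexp := LeakyCurve.mul_exp_neg_le (x := κ * Γ.radius) hCpos
  refine (mul_le_mul_right h _).trans ?_
  rw [← mul_assoc, ← ENNReal.ofReal_mul' (by positivity)]
  refine mul_le_of_le_one_left' ?_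
  rw [ENNReal.ofReal_le_one]
  have hden : 0 < (c * α + 1) ^ 2 * (κ ^ 2 + 1) := mul_pos (hApos.trans_le hA) (by positivity)
  calc κ * Γ.radius / ((c * α + 1) ^ 2 * (κ ^ 2 + 1)) * Real.exp (-C * κ * Γ.radius) *
        (C * (A * (κ ^ 2 + 1)))
      = (κ * Γ.radius * Real.exp (-C * (κ * Γ.radius))) *
          (C * (A * (κ ^ 2 + 1)) / ((c * α + 1) ^ 2 * (κ ^ 2 + 1))) := by
        rw [mul_assoc (-C)]
        ring
    _ ≤ 1 / C * (C * (A * (κ ^ 2 + 1)) / ((c * α + 1) ^ 2 * (κ ^ 2 + 1))) := by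
        gcongr
    _ = A / (c * α + 1) ^ 2 := by
        have : (c * α + 1) ^ 2 ≠ 0 := (hApos.trans_le hA).ne'
        field_simp
    _ ≤ 1 := div_le_one_of_le₀ hA (sq_nonneg _)

end
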